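/- Compact means quasi-compact and Hausdorff. A \emph{compactology} on a set $X$ is a non-empty collection $\mathscr C$ of subsets of $X$, each $K\in\mathscr C$ carrying a compact topology $\tau_K$, such that $\mathscr C$ covers $X$; any two members of $\mathscr C$ are contained in a third; $\tau_{K_2}=\tau_{K_1}|_{K_2}$ whenever $K_2\subseteq K_1$ are in $\mathscr C$; and every compact subset of $(K,\tau_K)$, $K\in\mathscr C$, belongs to $\mathscr C$. A \emph{compactological set} is a set with a compactology; a morphism $(X,\mathscr C)\to(X',\mathscr C')$ is a map $f$ such that for every $K\in\mathscr C$ one has $f(K)\in\mathscr C'$ and $f|_K\colon K\to f(K)$ is continuous. This gives the category $\mathrm{Cmp}$. For an uncountable strong limit cardinal $\kappa$, let $\mathrm{CHaus}_\kappa$ be the category of compact spaces of cardinality $<\kappa$, and $\mathrm{Cmp}_\kappa\subseteq\mathrm{Cmp}$ the full subcategory of those $(X,\mathscr C)$ with $|K|<\kappa$ for all $K\in\mathscr C$. Let $\iota\colon\mathrm{CHaus}_\kappa\to\mathrm{Cmp}_\kappa$ equip a compact space with all its compact subsets. A \emph{$\kappa$-condensed set} is a functor $X\colon\mathrm{CHaus}_\kappa^{\mathrm{op}}\to\mathrm{Set}$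 which sends finite coproducts to products and such that for every surjection $f\colon K\to L$ the map $X(f)$ is a bijection from $X(L)$ onto $\{\varphi\in X(K): X(\pi_1)(\varphi)=X(\pi_2)(\varphi)\}$, where $\pi_1,\pi_2\colon K\times_LK\to K$ are the projections; $\mathrm{Cond}_\kappa$ is the category of these, with natural transformations. For $\kappa<\kappa'$ the restriction functor $\mathrm{Cond}_{\kappa'}\to\mathrm{Cond}_\kappa$ has a fully faithful left adjoint, and $\mathrm{Cond}$ is the directed colimit of the categories $\mathrm{Cond}_\kappa$ along these left adjoints; equivalently, it is the full subcategory of the sheaves of sets on all compact spaces (same two conditions) formed by the values, for all $\kappa$, of the left adjoints of the restrictions to $\mathrm{CHaus}_\kappa$. Write $\underline K=\mathrm{Hom}(-,K)$. In $\mathrm{Cond}_\kappa$ or $\mathrm{Cond}$, an object $Z$ is \emph{quasicompact} if every jointly epimorphic family $(\underline{K_i}\to Z)_{i\in I}$ has a finite jointly epimorphic subfamily, and $X$ is \emph{quasiseparated} if $\underline K\times_X\underline K$ is quasicompact for all $K$ and all pairs of morphisms $\underline K\rightrightarrows X$. Let $\mathrm{qsCond}_\kappa$ and $\mathrm{qsCond}$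 be the full subcategories of quasiseparated objects. For $\varphi\in X(K)$ let $\varphi_*\colon K\to X(*)$, $\varphi_*(k)=X(*\xrightarrow{k}K)(\varphi)$. \textbf{Theorem.} (1) Let $\kappa$ be an uncountable strong limit cardinal. For $C\in\mathrm{Cmp}_\kappa$ the presheaf $\mathrm{Cmp}_\kappa(\iota(-),C)$ is a quasiseparated $\kappa$-condensed set. For $X\in\mathrm{qsCond}_\kappa$ the collection $\mathscr C_X=\{\varphi_*(K): K\in\mathrm{CHaus}_\kappa,\ \varphi\in X(K)\}$ is (with suitable topologies) a $\kappa$-small compactology on $X(*)$, and every morphism $\eta\colon X\to Y$ in $\mathrm{qsCond}_\kappa$ induces a morphism $\eta_*\colon(X(*),\mathscr C_X)\to(Y(*),\mathscr C_Y)$. The resulting functors $C\mapsto\mathrm{Cmp}_\kappa(\iota(-),C)$ and $X\mapsto(X(*),\mathscr C_X)$ are quasi-inverse equivalences between $\mathrm{Cmp}_\kappa$ and $\mathrm{qsCond}_\kappa$. (2) The same formulas, without the size restriction, define quasi-inverse equivalences between $\mathrm{Cmp}$ and $\mathrm{qsCond}$. They extend the equivalences of (1) along the directed colimits over $\kappa$: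 for $\kappa\le\kappa'$ and $C\in\mathrm{Cmp}_\kappa$ the restriction of $\mathrm{Cmp}_{\kappa'}(\iota(-),C)$ to $\mathrm{CHaus}_\kappa$ is naturally isomorphic to $\mathrm{Cmp}_\kappa(\iota(-),C)$, and this exhibits $\mathrm{Cmp}_{\kappa'}(\iota(-),C)$ as the value at $\mathrm{Cmp}_\kappa(\iota(-),C)$ of the left adjoint of restriction; likewise with $\kappa'$ replaced by no size restriction. The functors $\mathrm{Cond}_\kappa\to\mathrm{Cond}$ map $\mathrm{qsCond}_\kappa$ into $\mathrm{qsCond}$, and every object of $\mathrm{qsCond}$ is isomorphic to the image of an object of $\mathrm{qsCond}_\kappa$ for some $\kappa$. -/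

import Mathlib

open CategoryTheory Opposite Limits

universe u v w v' w'

/-! ### Compactological sets -/

/-- A compactology on a set `X`: a non-empty collection `sets` of subsets, each equipped with a
compact Hausdorff topology, which covers `X`, is upwards directed, has coherent topologies, and is
stable under compact subsets. -/
structure Compactology (X : Type u) where
  sets : Set (Set X)
  top : ∀ K : sets, TopologicalSpace (K : Set X)
  sets_nonempty : sets.Nonempty
  compactSpace : ∀ K : sets, @CompactSpace (K : Set X) (top K)
  t2Space : ∀ K : sets, @T2Space (K : Set X) (top K)
  covers : ⋃₀ sets = Set.univ
  directed : ∀ K₁ ∈ sets, ∀ K₂ ∈ sets, ∃ K₃ ∈ sets, K₁ ⊆ K₃ ∧ K₂ ⊆ K₃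
  coherent : ∀ (K₁ K₂ : sets) (h : (K₂ : Set X) ⊆ K₁),
    top K₂ = (top K₁).induced (Set.inclusion h)
  compact_mem : ∀ (K₁ : sets) (A : Set (K₁ : Set X)),
    @IsCompact (K₁ : Set X) (top K₁) A → Subtype.val '' A ∈ sets

/-- `f` is a morphism of compactological sets: it maps members `K` of the compactology to members,
and each corestriction `K → f(K)` is continuous. -/
structure IsCmpMap {X Y : Type u} (c : Compactology X) (d : Compactology Y) (f : X → Y) :
    Prop where
  image_mem : ∀ K ∈ c.sets, f '' K ∈ d.sets
  continuous : ∀ K : c.sets,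
    @Continuous (K : Set X) (f '' (K : Set X)) (c.top K) (d.top ⟨f '' K, image_mem K K.2⟩)
      (Set.imageFactorization f K)

theorem Compactology.continuous_inclusion {X : Type u} (c : Compactology X) (K L : c.sets)
    (h : (K : Set X) ⊆ L) :
    @Continuous _ _ (c.top K) (c.top L) (Set.inclusion h) := by
  rw [c.coherent L K h]
  exact continuous_induced_dom

theorem IsCmpMap.id {X : Type u} (c : Compactology X) : IsCmpMap c c id where
  image_mem K hK := by simpa using hK
  continuous K :=
    c.continuous_inclusion K ⟨_root_.id '' (K : Set X), by simp⟩ (by simp)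

theorem IsCmpMap.comp {X Y Z : Type u} {c : Compactology X} {d : Compactology Y}
    {e : Compactology Z} {f : X → Y} {g : Y → Z} (hg : IsCmpMap d e g) (hf : IsCmpMap c d f) :
    IsCmpMap c e (g ∘ f) where
  image_mem K hK := by
    rw [Set.image_comp]
    exact hg.image_mem _ (hf.image_mem _ hK)
  continuous K := by
    have hm : f '' (K : Set X) ∈ d.sets := hf.image_mem _ K.2
    have hm' : g '' (f '' (K : Set X)) ∈ e.sets := hg.image_mem _ hm
    have hm'' : (g ∘ f) '' (K : Set X) ∈ e.sets := by rw [Set.image_comp]; exact hm'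
    have h₁ := hf.continuous K
    have h₂ := hg.continuous ⟨_, hm⟩
    have h₃ := e.continuous_inclusion ⟨_, hm'⟩ ⟨_, hm''⟩ (Set.image_comp g f _).superset
    exact @Continuous.comp _ _ _ (c.top K) (e.top ⟨_, hm'⟩) (e.top ⟨_, hm''⟩) _ _ h₃
      (@Continuous.comp _ _ _ (c.top K) (d.top ⟨_, hm⟩) (e.top ⟨_, hm'⟩) _ _ h₂ h₁)

/-- A compactological set. -/
structure CmpSet : Type (u + 1) where
  carrier : Type u
  str : Compactology carrier

/-- A morphism of compactological sets. -/
@[ext]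
structure CmpSet.Hom (C D : CmpSet.{u}) : Type u where
  toFun : C.carrier → D.carrier
  isCmpMap : IsCmpMap C.str D.str toFun

instance : Category.{u} CmpSet.{u} where
  Hom := CmpSet.Hom
  id C := ⟨id, IsCmpMap.id C.str⟩
  comp f g := ⟨g.toFun ∘ f.toFun, g.isCmpMap.comp f.isCmpMap⟩

/-- The compactology of all compact subsets, with the subspace topologies, of a compact
Hausdorff space. -/
def compactologyOfCompact (K : Type u) [TopologicalSpace K] [CompactSpace K] [T2Space K] :
    Compactology K where
  sets := {A | IsCompact A}
  top _ := instTopologicalSpaceSubtype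
  sets_nonempty := ⟨∅, isCompact_empty⟩
  compactSpace A := isCompact_iff_compactSpace.mp A.2
  t2Space _ := inferInstance
  covers := Set.eq_univ_of_forall fun x => ⟨{x}, isCompact_singleton, rfl⟩
  directed A hA B hB := ⟨A ∪ B, hA.union hB, Set.subset_union_left, Set.subset_union_right⟩
  coherent _ _ _ := by
    simp only [instTopologicalSpaceSubtype, induced_compose]
    rfl
  compact_mem _ _ hB := hB.image continuous_subtype_val

theorem isCmpMap_of_continuous {K L : Type u} [TopologicalSpace K] [CompactSpace K] [T2Space K]
    [TopologicalSpace L] [CompactSpace L] [T2Space L] {f : K → L} (hf : Continuous f) :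
    IsCmpMap (compactologyOfCompact K) (compactologyOfCompact L) f where
  image_mem _ hA := hA.image hf
  continuous _ := Continuous.subtype_mk (hf.comp continuous_subtype_val) _

/-! ### Size restrictions -/

/-- Size bounds: `κ` is either an uncountable strong limit cardinal, or `⊤`, meaning that no size
restriction is imposed (within the universe `Type u` of sets). -/
def Size : Type (u + 1) :=
  {κ : WithTop Cardinal.{u} //
    ∀ μ : Cardinal.{u}, κ = μ → Cardinal.aleph0 < μ ∧ μ.IsStrongLimit}

instance : PartialOrder Size.{u} := inferInstanceAs (PartialOrder (Subtype _))

/-- An uncountable strong limit cardinal as a size bound. -/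
def Size.of (κ : Cardinal.{u}) (h₀ : Cardinal.aleph0 < κ) (h : κ.IsStrongLimit) : Size.{u} :=
  ⟨(κ : WithTop Cardinal.{u}), fun μ hμ => by
    obtain rfl : κ = μ := WithTop.coe_injective hμ
    exact ⟨h₀, h⟩⟩

/-- No size restriction. -/
def Size.all : Size.{u} := ⟨⊤, fun _ h => (WithTop.top_ne_coe h).elim⟩

theorem Size.le_all (κ : Size.{u}) : κ ≤ Size.all := (le_top : κ.1 ≤ ⊤)

/-- The cardinality of the type `α` is less than `κ` (always true for `κ = ⊤`). -/
def Size.Bounds (κ : Size.{u}) (α : Type u) : Prop :=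
  ((Cardinal.mk α : Cardinal.{u}) : WithTop Cardinal.{u}) < κ.1

theorem Size.Bounds.mono {κ κ' : Size.{u}} (h : κ ≤ κ') {α : Type u} (hα : κ.Bounds α) :
    κ'.Bounds α :=
  lt_of_lt_of_le hα h

theorem Size.Bounds.of_le {κ : Size.{u}} {α β : Type u} (h : Cardinal.mk β ≤ Cardinal.mk α)
    (hα : κ.Bounds α) : κ.Bounds β :=
  lt_of_le_of_lt (WithTop.coe_le_coe.mpr h) hα

theorem Size.bounds_punit (κ : Size.{u}) : κ.Bounds PUnit.{u + 1} := by
  obtain ⟨κ, hκ⟩ := κ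
  induction κ using WithTop.recTopCoe with
  | top => exact WithTop.coe_lt_top _
  | coe μ =>
    refine WithTop.coe_lt_coe.mpr ?_
    rw [Cardinal.mk_punit]
    exact Cardinal.one_lt_aleph0.trans (hκ μ rfl).1

/-- Every set is smaller than some uncountable strong limit cardinal. -/
theorem Size.exists_bounds (α : Type u) :
    ∃ (κ : Cardinal.{u}) (h₀ : Cardinal.aleph0 < κ) (h : κ.IsStrongLimit),
      (Size.of κ h₀ h).Bounds α := by
  set o : Ordinal.{u} := (Cardinal.mk α).ord + Ordinal.omega0 with ho
  have hlim : Order.IsSuccLimit o :=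
    Ordinal.isSuccLimit_add _ Ordinal.isSuccLimit_omega0
  have hlt : (Cardinal.mk α).ord < o := by
    simp [ho]
  have hpos : 0 < o := lt_of_le_of_lt zero_le hlt
  refine ⟨Cardinal.beth o, ?_, Cardinal.isStrongLimit_beth.mpr hlim.isSuccPrelimit, ?_⟩
  · rw [← Cardinal.beth_zero]
    exact Cardinal.beth_lt_beth.mpr hpos
  · exact WithTop.coe_lt_coe.mpr
      ((Cardinal.le_beth_ord _).trans_lt (Cardinal.beth_lt_beth.mpr hlt))

/-- The category `CHaus_κ` of compact Hausdorff spaces of cardinality less than `κ`. -/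
abbrev CHaus (κ : Size.{u}) : Type (u + 1) :=
  ObjectProperty.FullSubcategory fun K : CompHaus.{u} => κ.Bounds K

/-- The one-point space in `CHaus_κ`. -/
def CHaus.pt (κ : Size.{u}) : CHaus κ := ⟨CompHaus.of PUnit.{u + 1}, κ.bounds_punit⟩

/-- The map from the one-point space with value `k`. -/
def CHaus.const {κ : Size.{u}} (K : CHaus κ) (k : K.obj) : CHaus.pt κ ⟶ K :=
  ObjectProperty.homMk (CompHausLike.ofHom _ ⟨fun _ => k, continuous_const⟩)

/-- The inclusion `CHaus_κ ⥤ CHaus_κ'` for `κ ≤ κ'`. -/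
abbrev CHaus.incl {κ κ' : Size.{u}} (h : κ ≤ κ') : CHaus κ ⥤ CHaus κ' :=
  ObjectProperty.ιOfLE fun _ hK => Size.Bounds.mono h hK

/-- The category `Cmp_κ` of `κ`-compactological sets: all members of the compactology have
cardinality less than `κ`. For `κ = ⊤` these are all compactological sets. -/
abbrev Cmp (κ : Size.{u}) : Type (u + 1) :=
  ObjectProperty.FullSubcategory fun C : CmpSet.{u} => ∀ K ∈ C.str.sets, κ.Bounds K

/-- The inclusion `Cmp_κ ⥤ Cmp_κ'` for `κ ≤ κ'`. -/
abbrev Cmp.incl {κ κ' : Size.{u}} (h : κ ≤ κ') : Cmp κ ⥤ Cmp κ' :=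
  ObjectProperty.ιOfLE fun _ hC K hK => Size.Bounds.mono h (hC K hK)

/-- The embedding `CHaus_κ ⥤ Cmp_κ`, equipping a compact space with the compactology of all its
compact subsets. -/
def CHaus.toCmp (κ : Size.{u}) : CHaus κ ⥤ Cmp κ where
  obj K := ⟨⟨K.obj, compactologyOfCompact K.obj⟩,
    fun A _ => Size.Bounds.of_le (Cardinal.mk_set_le A) K.property⟩
  map f := ObjectProperty.homMk
    (⟨f.hom, isCmpMap_of_continuous f.hom.hom.hom.continuous⟩ : CmpSet.Hom _ _)

/-! ### Condensed sets -/

/-- The sheaf conditions on a presheaf of sets on `CHaus_κ`: finite coproducts are sent to products,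
and for every surjection `f : K → L`, pullback along `f` is a bijection from `X(L)` onto
`{φ ∈ X(K) | π₁^* φ = π₂^* φ}`, where `π₁, π₂ : K ×_L K → K` are the projections. -/
structure IsCondensed (κ : Size.{u}) (X : (CHaus κ)ᵒᵖ ⥤ Type u) : Prop where
  preservesFiniteProducts : PreservesFiniteProducts X
  existsUnique : ∀ ⦃K L : CHaus κ⦄ (f : K ⟶ L), Function.Surjective f.hom →
    ∀ ⦃R : CHaus κ⦄ (π₁ π₂ : R ⟶ K), IsPullback π₁ π₂ f f →
      ∀ φ : X.obj (op K), X.map π₁.op φ = X.map π₂.op φ → ∃! ψ : X.obj (op L), X.map f.op ψ = φ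

/-- For an uncountable strong limit cardinal `κ`, the category `Cond_κ` of `κ`-condensed sets.
For `κ = ⊤`, the category of all sheaves of sets on the category of compact Hausdorff spaces. -/
abbrev CondSet (κ : Size.{u}) : Type (u + 1) :=
  ObjectProperty.FullSubcategory (IsCondensed κ)

/-- Restriction of presheaves from `CHaus_κ'` to `CHaus_κ`, for `κ ≤ κ'`. -/
abbrev presheafRes {κ κ' : Size.{u}} (h : κ ≤ κ') :
    ((CHaus κ')ᵒᵖ ⥤ Type u) ⥤ ((CHaus κ)ᵒᵖ ⥤ Type u) :=
  (Functor.whiskeringLeft _ _ _).obj (CHaus.incl h).op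

/-- `e : X ⟶ Y|_{CHaus_κ}` is a universal arrow from `X` to the restriction functor
`Cond_κ' ⥤ Cond_κ`. In other words, `Y` together with `e` is the value at `X` of the left adjoint
`Cond_κ ⥤ Cond_κ'` of restriction (the transition functor of the system of the `Cond_κ`), and `e`
is the unit of the adjunction. -/
def IsUniversalRes {κ κ' : Size.{u}} (h : κ ≤ κ') {X : CondSet κ} {Y : CondSet κ'}
    (e : X.obj ⟶ (presheafRes h).obj Y.obj) : Prop :=
  ∀ W : CondSet κ', Function.Bijective fun η : Y ⟶ W => e ≫ (presheafRes h).map η.hom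

theorem isCondensed_yoneda {κ : Size.{u}} (M : CHaus κ) : IsCondensed κ (yoneda.obj M) where
  preservesFiniteProducts := inferInstance
  existsUnique := by
    intro K L f hf R π₁ π₂ hR φ hφ
    change π₁ ≫ φ = π₂ ≫ φ at hφ
    have key : ∀ a b : K.obj, f.hom a = f.hom b → φ.hom a = φ.hom b := by
      intro a b hab
      have hw : CHaus.const K a ≫ f = CHaus.const K b ≫ f := by
        ext x
        exact hab
      have h₁ := hR.lift_fst _ _ hw
      have h₂ := hR.lift_snd _ _ hw
      have h₃ : CHaus.const K a ≫ φ = CHaus.const K b ≫ φ := by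
        calc CHaus.const K a ≫ φ = (hR.lift _ _ hw ≫ π₁) ≫ φ := by rw [h₁]
          _ = (hR.lift _ _ hw ≫ π₂) ≫ φ := by rw [Category.assoc, hφ, Category.assoc]
          _ = CHaus.const K b ≫ φ := by rw [h₂]
      exact congrArg (fun g : CHaus.pt κ ⟶ M => g.hom PUnit.unit) h₃
    have hfc : Continuous f.hom := f.hom.hom.hom.continuous
    have hq : Topology.IsQuotientMap f.hom := hfc.isClosedMap.isQuotientMap hfc hf
    let ψ : L ⟶ M := ObjectProperty.homMk (CompHausLike.ofHom _
      (hq.lift ⟨φ.hom, φ.hom.hom.hom.continuous⟩ key))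
    have hψ : f ≫ ψ = φ := by
      ext x
      exact key _ _ (Function.surjInv_eq hf _)
    refine ⟨ψ, hψ, fun χ hχ => ?_⟩
    change f ≫ χ = φ at hχ
    refine ObjectProperty.hom_ext _ (ConcreteCategory.hom_ext _ _ fun x => ?_)
    obtain ⟨k, rfl⟩ := hf x
    exact congrArg (fun g : K ⟶ M => g.hom k) (hχ.trans hψ.symm)

/-- The functor `K ↦ Hom(-, K)` from `CHaus_κ` to `κ`-condensed sets. -/
def CondSet.rep (κ : Size.{u}) : CHaus κ ⥤ CondSet κ :=
  ObjectProperty.lift _ yoneda isCondensed_yoneda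

/-- A sheaf on the category of all compact Hausdorff spaces comes from a `κ`-condensed set, for
some uncountable strong limit cardinal `κ`. -/
def IsSmallCondensed (Y : CondSet Size.all.{u}) : Prop :=
  ∃ (κ : Cardinal.{u}) (h₀ : Cardinal.aleph0 < κ) (h : κ.IsStrongLimit)
    (X : CondSet (Size.of κ h₀ h))
    (e : X.obj ⟶ (presheafRes (Size.le_all (Size.of κ h₀ h))).obj Y.obj),
    IsUniversalRes (Size.le_all _) e

/-- The category `Cond` of all condensed sets: the directed colimit of the categories `Cond_κ` along
the fully faithful left adjoints of the restriction functors, realised as the union of the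
essential images of the `Cond_κ` in the category of sheaves on all compact Hausdorff spaces. -/
abbrev Cond : Type (u + 1) := ObjectProperty.FullSubcategory IsSmallCondensed.{u}

theorem isSmallCondensed_rep (K : CHaus Size.all.{u}) :
    IsSmallCondensed ((CondSet.rep Size.all).obj K) := by
  obtain ⟨κ, h₀, h, hK⟩ := Size.exists_bounds K.obj
  let K' : CHaus (Size.of κ h₀ h) := ⟨K.obj, hK⟩
  refine ⟨κ, h₀, h, (CondSet.rep _).obj K',
    yonedaEquiv.symm (𝟙 K : K ⟶ K), ?_⟩
  intro W
  have hinj : Function.Injective fun η : (CondSet.rep Size.all).obj K ⟶ W =>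
      (yonedaEquiv (F := W.obj)) η.hom := fun η θ h => by
    ext1
    exact yonedaEquiv.injective h
  have key : ∀ η : (CondSet.rep Size.all).obj K ⟶ W,
      (yonedaEquiv (X := K') (F := (presheafRes (Size.le_all _)).obj W.obj))
        (yonedaEquiv.symm (𝟙 K : K ⟶ K) ≫ (presheafRes (Size.le_all _)).map η.hom) =
      (yonedaEquiv (F := W.obj)) η.hom := fun η => by
    refine (yonedaEquiv_comp _ _).trans ?_
    exact congrArg (η.hom.app (op K)) (Equiv.apply_symm_apply yonedaEquiv _)
  constructor
  · intro η θ h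
    refine hinj ?_
    change (yonedaEquiv (F := W.obj)) η.hom = (yonedaEquiv (F := W.obj)) θ.hom
    rw [← key η, ← key θ]
    exact congrArg _ h
  · intro θ
    refine ⟨ObjectProperty.homMk
      (yonedaEquiv.symm ((yonedaEquiv (X := K')
        (F := (presheafRes (Size.le_all _)).obj W.obj)) θ)), ?_⟩
    apply (yonedaEquiv (X := K') (F := (presheafRes (Size.le_all _)).obj W.obj)).injective
    refine (key _).trans ?_
    exact Equiv.apply_symm_apply _ _

/-- The functor `K ↦ Hom(-, K)` from compact Hausdorff spaces to condensed sets. -/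
def Cond.rep : CHaus Size.all.{u} ⥤ Cond.{u} :=
  ObjectProperty.lift _ (CondSet.rep Size.all) isSmallCondensed_rep

/-! ### Quasicompact and quasiseparated objects -/

section Quasiseparated

variable {𝒦 : Type w} [Category.{v} 𝒦] {𝒞 : Type w'} [Category.{v'} 𝒞]

/-- A family of morphisms `y(K i) ⟶ X` is a covering if it is jointly epimorphic. -/
def IsCovering (y : 𝒦 ⥤ 𝒞) {X : 𝒞} {I : Type u} (K : I → 𝒦) (f : ∀ i, y.obj (K i) ⟶ X) : Prop :=
  ∀ ⦃Y : 𝒞⦄ (g h : X ⟶ Y), (∀ i, f i ≫ g = f i ≫ h) → g = h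

/-- `X` is quasicompact (with respect to the representables `y(K)`): every covering has a finite
subcovering. -/
def IsQuasicompact (y : 𝒦 ⥤ 𝒞) (X : 𝒞) : Prop :=
  ∀ (I : Type u) (K : I → 𝒦) (f : ∀ i, y.obj (K i) ⟶ X), IsCovering y K f →
    ∃ s : Finset I, IsCovering y (fun i : s => K i) (fun i : s => f i)

/-- `X` is quasiseparated: every fibre product `y(K) ×_X y(K)` is quasicompact. -/
def IsQuasiseparated (y : 𝒦 ⥤ 𝒞) (X : 𝒞) : Prop :=
  ∀ (K : 𝒦) (f g : y.obj K ⟶ X) (Z : 𝒞) (p q : Z ⟶ y.obj K),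
    IsPullback p q f g → IsQuasicompact.{u} y Z

end Quasiseparated

/-- The category of quasiseparated `κ`-condensed sets. -/
abbrev QsCondSet (κ : Size.{u}) : Type (u + 1) :=
  ObjectProperty.FullSubcategory (IsQuasiseparated.{u} (CondSet.rep κ))

/-- The category of quasiseparated condensed sets. -/
abbrev QsCond : Type (u + 1) :=
  ObjectProperty.FullSubcategory (IsQuasiseparated.{u} Cond.rep.{u})

/-- The forgetful functor from quasiseparated `κ`-condensed sets to presheaves. -/
abbrev QsCondSet.toPresheaf (κ : Size.{u}) : QsCondSet κ ⥤ ((CHaus κ)ᵒᵖ ⥤ Type u) :=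
  ObjectProperty.ι _ ⋙ ObjectProperty.ι _

/-- The forgetful functor from quasiseparated condensed sets to presheaves. -/
abbrev QsCond.toPresheaf : QsCond.{u} ⥤ ((CHaus Size.all.{u})ᵒᵖ ⥤ Type u) :=
  ObjectProperty.ι _ ⋙ ObjectProperty.ι _ ⋙ ObjectProperty.ι _

/-! ### The two functors -/

/-- The restricted Yoneda functor `C ↦ Cmp_κ(ι(-), C)`, with values in presheaves on `CHaus_κ`. -/
def restrictedYoneda (κ : Size.{u}) : Cmp κ ⥤ ((CHaus κ)ᵒᵖ ⥤ Type u) :=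
  yoneda ⋙ (Functor.whiskeringLeft _ _ _).obj (CHaus.toCmp κ).op

/-- The restricted Yoneda functor with values in `κ`-condensed sets, given that its values satisfy
the sheaf conditions. -/
abbrev yonedaCondSet (κ : Size.{u})
    (hc : ∀ C : Cmp κ, IsCondensed κ ((restrictedYoneda κ).obj C)) : Cmp κ ⥤ CondSet κ :=
  ObjectProperty.lift _ (restrictedYoneda κ) hc

/-- The restricted Yoneda functor with values in quasiseparated `κ`-condensed sets. -/
abbrev yonedaQsCondSet (κ : Size.{u})
    (hc : ∀ C : Cmp κ, IsCondensed κ ((restrictedYoneda κ).obj C))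
    (hq : ∀ C : Cmp κ, IsQuasiseparated.{u} (CondSet.rep κ) ((yonedaCondSet κ hc).obj C)) :
    Cmp κ ⥤ QsCondSet κ :=
  ObjectProperty.lift _ (yonedaCondSet κ hc) hq

/-- The restricted Yoneda functor, without size restriction, with values in condensed sets. -/
abbrev yonedaCond (hc : ∀ C : Cmp Size.all.{u}, IsCondensed Size.all ((restrictedYoneda _).obj C))
    (hs : ∀ C : Cmp Size.all.{u}, IsSmallCondensed ((yonedaCondSet Size.all hc).obj C)) :
    Cmp Size.all.{u} ⥤ Cond.{u} :=
  ObjectProperty.lift _ (yonedaCondSet Size.all hc) hs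

/-- The restricted Yoneda functor, without size restriction, with values in quasiseparated
condensed sets. -/
abbrev yonedaQsCond
    (hc : ∀ C : Cmp Size.all.{u}, IsCondensed Size.all ((restrictedYoneda _).obj C))
    (hs : ∀ C : Cmp Size.all.{u}, IsSmallCondensed ((yonedaCondSet Size.all hc).obj C))
    (hq : ∀ C : Cmp Size.all.{u}, IsQuasiseparated.{u} Cond.rep ((yonedaCond hc hs).obj C)) :
    Cmp Size.all.{u} ⥤ QsCond.{u} :=
  ObjectProperty.lift _ (yonedaCond hc hs) hq

/-- The underlying set `X(*)`. -/
abbrev underlyingSet {κ : Size.{u}} (X : (CHaus κ)ᵒᵖ ⥤ Type u) : Type u :=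
  X.obj (op (CHaus.pt κ))

/-- The map `φ_* : K → X(*)` attached to `φ ∈ X(K)`, sending `k` to the pullback of `φ` along the
map `* → K` with value `k`. -/
def pointMap {κ : Size.{u}} (X : (CHaus κ)ᵒᵖ ⥤ Type u) {K : CHaus κ} (φ : X.obj (op K))
    (k : K.obj) : underlyingSet X :=
  X.map (CHaus.const K k).op φ

/-- The collection of the images of the maps `φ_*`, for all `K` in `CHaus_κ` and `φ ∈ X(K)`. -/
def imageSets {κ : Size.{u}} (X : (CHaus κ)ᵒᵖ ⥤ Type u) : Set (Set (underlyingSet X)) :=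
  {S | ∃ (K : CHaus κ) (φ : X.obj (op K)), S = Set.range (pointMap X φ)}

/-- For a category `𝒟` of presheaves on `CHaus_κ` (given by a functor `j`), the assertion, together
with the necessary topologies, that for each `X` in `𝒟` the images of the maps `φ_*` form
a compactology on `X(*)`, and that each morphism of `𝒟` induces on underlying sets a morphism of
compactological sets. The topologies are determined by the collection of sets. -/
structure UnderlyingCompactology {κ : Size.{u}} {𝒟 : Type w} [Category.{v} 𝒟]
    (j : 𝒟 ⥤ ((CHaus κ)ᵒᵖ ⥤ Type u)) where
  cmp : ∀ X : 𝒟, Compactology (underlyingSet (j.obj X))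
  sets_eq : ∀ X : 𝒟, (cmp X).sets = imageSets (j.obj X)
  isCmpMap : ∀ ⦃X Y : 𝒟⦄ (η : X ⟶ Y),
    IsCmpMap (cmp X) (cmp Y) ((j.map η).app (op (CHaus.pt κ)))

/-- The functor sending `X` to its underlying compactological set
`(X(*), {images of φ_* | φ ∈ X(K), K ∈ CHaus_κ})`, and `η` to its component at the point. -/
def UnderlyingCompactology.functor {κ : Size.{u}} {𝒟 : Type w} [Category.{v} 𝒟]
    {j : 𝒟 ⥤ ((CHaus κ)ᵒᵖ ⥤ Type u)} (U : UnderlyingCompactology j) : 𝒟 ⥤ Cmp κ where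
  obj X := ⟨⟨underlyingSet (j.obj X), U.cmp X⟩, fun S hS => by
    have hS' : S ∈ imageSets (j.obj X) := U.sets_eq X ▸ hS
    obtain ⟨K, φ, rfl⟩ := hS'
    exact Size.Bounds.of_le Cardinal.mk_range_le K.property⟩
  map η := ObjectProperty.homMk (⟨_, U.isCmpMap η⟩ : CmpSet.Hom _ _)
  map_id X := by
    apply ObjectProperty.hom_ext
    apply CmpSet.Hom.ext
    funext x
    change (j.map (𝟙 X)).app _ x = x
    simp
  map_comp f g := by
    apply ObjectProperty.hom_ext
    apply CmpSet.Hom.ext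
    funext x
    change (j.map (f ≫ g)).app _ x = (j.map g).app _ ((j.map f).app _ x)
    simp

/-! ### Closure properties of size bounds -/

/-! Quasiseparatedness is replaced by a concrete condition, closed coincidence
(`HasClosedCoincidence`): for sections φ over K and ψ over L, the pairs (k, l) with φ_*(k) = ψ_*(l)
form a closed subset of K × L, on which φ and ψ agree as sections. The two conditions are equivalent
by `CondEmbedding.isQuasiseparated_iff`.

If coincidence is closed, the fibre product of two morphisms from Hom(-, K) is Hom(-, A) with A
closed in K × K, so it remains to see that representables are quasicompact. Coverings are only
assumed jointly epimorphic, hence a test object is needed. Given K_i → E, let N be the ideal of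
subsets of E contained in finitely many of the images, and glue two copies of Hom(-, E) along the
maps with image in N. The two inclusions agree on every K_i, so they are equal, which means E ∈ N.
Conversely, the fibre product Z of two maps into a quasiseparated object is covered by the closed
subsets of K × K on which the two sections agree. The union A of a finite subcovering contains every
coincidence point: a Urysohn function separating A from a missing point would give two maps from Z
to [0,1] that agree on the subcovering but differ at that point.

For a compactological set, two sections land in a common Hausdorff member, so coincidence is closed.
For X with closed coincidence, φ_*(K) receives the quotient topology from K. The kernel relation is
closed, so this is compact Hausdorff, and it depends only on the set φ_*(K). Sections are determined
by φ_*, and the maps φ_* are exactly the morphisms of compactological sets from K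
(`exists_pointMap_eq`, by descent). Both natural isomorphisms follow.

For the change of κ, a sheaf whose sections are locally pulled back from κ-bounded spaces is the
value of the left adjoint at its restriction (`isUniversalRes_of_isLocallyBounded`). This applies to
the sheaf of a κ-compactological set, because a map from a compact space factors through a member.
It also applies to the glued sheaves and the fibre products, so that these auxiliary objects exist
in Cond. `CondEmbedding` records this, so that one argument serves Cond_κ and Cond. -/

theorem Size.Bounds.prod {κ : Size.{u}} {α β : Type u} (hα : κ.Bounds α) (hβ : κ.Bounds β) :
    κ.Bounds (α × β) := by
  obtain ⟨κ, hκ⟩ := κ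
  induction κ using WithTop.recTopCoe with
  | top => exact WithTop.coe_lt_top _
  | coe μ =>
    refine WithTop.coe_lt_coe.mpr ?_
    rw [Cardinal.mk_prod, Cardinal.lift_id, Cardinal.lift_id]
    exact Cardinal.mul_lt_of_lt (hκ μ rfl).1.le (WithTop.coe_lt_coe.mp hα)
      (WithTop.coe_lt_coe.mp hβ)

theorem Size.bounds_of_finite (κ : Size.{u}) (α : Type u) [Finite α] : κ.Bounds α := by
  obtain ⟨κ, hκ⟩ := κ
  induction κ using WithTop.recTopCoe with
  | top => exact WithTop.coe_lt_top _
  | coe μ =>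
    exact WithTop.coe_lt_coe.mpr ((Cardinal.mk_lt_aleph0 (α := α)).trans (hκ μ rfl).1)

theorem Size.Bounds.sigma {κ : Size.{u}} {J : Type u} [Finite J] {α : J → Type u}
    (hα : ∀ j, κ.Bounds (α j)) : κ.Bounds (Σ j, α j) := by
  cases isEmpty_or_nonempty J with
  | inl h => exact κ.bounds_of_finite _
  | inr h =>
    obtain ⟨m, hm⟩ := Finite.exists_max fun j => Cardinal.mk (α j)
    refine Size.Bounds.of_le (α := J × α m) ?_ ((κ.bounds_of_finite J).prod (hα m))
    rw [Cardinal.mk_sigma, Cardinal.mk_prod, Cardinal.lift_id, Cardinal.lift_id]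
    exact (Cardinal.sum_le_sum _ (fun _ => Cardinal.mk (α m)) hm).trans (by simp)

theorem Size.Bounds.of_injective {κ : Size.{u}} {α β : Type u} (hα : κ.Bounds α) {f : β → α}
    (hf : Function.Injective f) : κ.Bounds β :=
  hα.of_le (Cardinal.mk_le_of_injective hf)

theorem Size.Bounds.subtype {κ : Size.{u}} {α : Type u} (hα : κ.Bounds α) (s : Set α) :
    κ.Bounds s :=
  hα.of_injective Subtype.val_injective

/-- The interval is the target of the Urysohn functions used below, so it must belong to `CHaus κ`.
A strong limit above ℵ₀ also exceeds the continuum. -/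
theorem Size.bounds_unitInterval (κ : Size.{u}) : κ.Bounds (ULift.{u} unitInterval) := by
  obtain ⟨κ, hκ⟩ := κ
  induction κ using WithTop.recTopCoe with
  | top => exact WithTop.coe_lt_top _
  | coe μ =>
    refine WithTop.coe_lt_coe.mpr ?_
    have h : Cardinal.mk (ULift.{u} unitInterval) ≤ Cardinal.continuum.{u} := by
      rw [Cardinal.mk_uLift, Cardinal.mk_Icc_real zero_lt_one, Cardinal.lift_continuum]
    refine h.trans_lt ?_
    rw [← Cardinal.two_power_aleph0]
    exact (hκ μ rfl).2.isStrongPrelimit (hκ μ rfl).1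

/-! ### Compact Hausdorff spaces of bounded size -/

namespace CHaus

variable {κ : Size.{u}}

/-- A compact Hausdorff space of bounded size as an object of `CHaus_κ`. -/
abbrev of (T : Type u) [TopologicalSpace T] [CompactSpace T] [T2Space T] (h : κ.Bounds T) :
    CHaus κ :=
  ⟨CompHaus.of T, h⟩

/-- A continuous map as a morphism of `CHaus_κ`. -/
def homOf {K L : CHaus κ} (f : K.obj → L.obj) (hf : Continuous f) : K ⟶ L :=
  ObjectProperty.homMk (ConcreteCategory.ofHom (C := CompHaus) ⟨f, hf⟩)

theorem continuous_hom {K L : CHaus κ} (f : K ⟶ L) : Continuous f.hom :=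
  f.hom.hom.hom.continuous

theorem hom_ext {K L : CHaus κ} {f g : K ⟶ L} (h : ∀ k, f.hom k = g.hom k) : f = g :=
  ObjectProperty.hom_ext _ (ConcreteCategory.hom_ext _ _ h)

theorem const_comp {K L : CHaus κ} (f : K ⟶ L) (k : K.obj) :
    const K k ≫ f = const L (f.hom k) :=
  rfl

theorem isQuotientMap {K L : CHaus κ} (f : K ⟶ L) (hf : Function.Surjective f.hom) :
    Topology.IsQuotientMap f.hom :=
  (continuous_hom f).isClosedMap.isQuotientMap (continuous_hom f) hf

/-- A closed subset of an object of `CHaus_κ`. -/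
abbrev ofClosed (K : CHaus κ) (A : Set K.obj) (hA : IsClosed A) : CHaus κ :=
  haveI : CompactSpace A := isCompact_iff_compactSpace.mp hA.isCompact
  of A (K.property.subtype A)

/-- The inclusion of a closed subset. -/
def closedIncl (K : CHaus κ) (A : Set K.obj) (hA : IsClosed A) : ofClosed K A hA ⟶ K :=
  homOf (K := ofClosed K A hA) (fun x : A => (x : K.obj)) continuous_subtype_val

/-- Corestriction of a morphism to a closed subset. -/
def closedLift {K L : CHaus κ} (A : Set K.obj) (hA : IsClosed A) (f : L ⟶ K)
    (hf : ∀ l, f.hom l ∈ A) : L ⟶ ofClosed K A hA :=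
  homOf (L := ofClosed K A hA) (fun l => (⟨f.hom l, hf l⟩ : A))
    ((continuous_hom f).subtype_mk hf)

theorem isClosed_range {K L : CHaus κ} (f : K ⟶ L) : IsClosed (Set.range f.hom) :=
  (isCompact_range (continuous_hom f)).isClosed

/-- The corestriction of a morphism to its image. -/
def toRange {K L : CHaus κ} (f : K ⟶ L) : K ⟶ ofClosed L (Set.range f.hom) (isClosed_range f) :=
  closedLift _ _ f fun k => ⟨k, rfl⟩

theorem toRange_surjective {K L : CHaus κ} (f : K ⟶ L) :
    Function.Surjective (toRange f).hom := by
  rintro ⟨_, k, rfl⟩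
  exact ⟨k, rfl⟩

/-- The product of two objects of `CHaus_κ`. -/
abbrev prod (K L : CHaus κ) : CHaus κ := of (K.obj × L.obj) (K.property.prod L.property)

/-- The first projection. -/
def fst (K L : CHaus κ) : prod K L ⟶ K := homOf (K := prod K L) Prod.fst continuous_fst

/-- The second projection. -/
def snd (K L : CHaus κ) : prod K L ⟶ L := homOf (K := prod K L) Prod.snd continuous_snd

/-- The morphism to a product with given components. -/
def pair {K L M : CHaus κ} (f : M ⟶ K) (g : M ⟶ L) : M ⟶ prod K L :=
  homOf (L := prod K L) (fun m => (f.hom m, g.hom m))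
    ((continuous_hom f).prodMk (continuous_hom g))

theorem isClosed_eqLocus {K L M : CHaus κ} (f : K ⟶ M) (g : L ⟶ M) :
    IsClosed {x : (prod K L).obj | f.hom ((fst K L).hom x) = g.hom ((snd K L).hom x)} :=
  isClosed_eq ((continuous_hom f).comp (continuous_hom _))
    ((continuous_hom g).comp (continuous_hom _))

/-- The fibre product in `CHaus_κ`. -/
abbrev pullback {K L M : CHaus κ} (f : K ⟶ M) (g : L ⟶ M) : CHaus κ :=
  ofClosed (prod K L) _ (isClosed_eqLocus f g)

/-- The first projection of the fibre product. -/
def pullbackFst {K L M : CHaus κ} (f : K ⟶ M) (g : L ⟶ M) : pullback f g ⟶ K :=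
  closedIncl _ _ _ ≫ fst K L

/-- The second projection of the fibre product. -/
def pullbackSnd {K L M : CHaus κ} (f : K ⟶ M) (g : L ⟶ M) : pullback f g ⟶ L :=
  closedIncl _ _ _ ≫ snd K L

theorem pullback_condition {K L M : CHaus κ} (f : K ⟶ M) (g : L ⟶ M) :
    pullbackFst f g ≫ f = pullbackSnd f g ≫ g :=
  hom_ext fun x => x.2

/-- The morphism to the fibre product with given components. -/
def pullbackLift {K L M N : CHaus κ} (f : K ⟶ M) (g : L ⟶ M) (a : N ⟶ K) (b : N ⟶ L)
    (h : a ≫ f = b ≫ g) : N ⟶ pullback f g :=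
  closedLift _ _ (pair a b) fun n => congrArg (fun t : N ⟶ M => t.hom n) h

theorem pullbackFst_surjective {K L M : CHaus κ} (f : K ⟶ M) (g : L ⟶ M)
    (hg : Function.Surjective g.hom) : Function.Surjective (pullbackFst f g).hom := fun k => by
  obtain ⟨l, hl⟩ := hg (f.hom k)
  exact ⟨⟨(k, l), hl.symm⟩, rfl⟩

theorem isPullback {K L M : CHaus κ} (f : K ⟶ M) (g : L ⟶ M) :
    IsPullback (pullbackFst f g) (pullbackSnd f g) f g where
  w := pullback_condition f g
  isLimit' := ⟨PullbackCone.IsLimit.mk _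
    (fun s => pullbackLift f g s.fst s.snd s.condition)
    (fun _ => rfl) (fun _ => rfl)
    (fun s _ h₁ h₂ => hom_ext fun n => Subtype.ext (Prod.ext
      (congrArg (fun t : s.pt ⟶ K => t.hom n) h₁) (congrArg (fun t : s.pt ⟶ L => t.hom n) h₂)))⟩

section Sigma

variable {J : Type u} [Finite J] (K : J → CHaus κ)

/-- The coproduct of a finite family of objects of `CHaus_κ`. -/
abbrev sigma : CHaus κ := of (Σ j, (K j).obj) (Size.Bounds.sigma fun j => (K j).property)

/-- The inclusions into a finite coproduct. -/
def sigmaι (j : J) : K j ⟶ sigma K :=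
  homOf (L := sigma K) (fun x => (⟨j, x⟩ : Σ j, (K j).obj))
    (continuous_sigmaMk (σ := fun j => (K j).obj))

/-- The morphism from a finite coproduct with given components. -/
def sigmaDesc {L : CHaus κ} (f : ∀ j, K j ⟶ L) : sigma K ⟶ L :=
  homOf (K := sigma K) (fun x : Σ j, (K j).obj => (f x.1).hom x.2)
    (continuous_sigma fun j => continuous_hom (f j))

@[simp]
theorem sigmaι_desc {L : CHaus κ} (f : ∀ j, K j ⟶ L) (j : J) :
    sigmaι K j ≫ sigmaDesc K f = f j :=
  rfl

/-- The cofan of the inclusions is a coproduct. -/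
def isColimitSigma : IsColimit (Cofan.mk (sigma K) (sigmaι K)) :=
  Cofan.IsColimit.mk _ (fun s => sigmaDesc K fun j => s.inj j) (fun _ _ => rfl)
    fun s _ hm => hom_ext fun x =>
      congrArg (fun t : K x.1 ⟶ s.pt => t.hom x.2) (hm x.1)

end Sigma

end CHaus

/-! ### Elementwise form of the sheaf conditions -/

section Presheaf

variable {κ : Size.{u}} {X : (CHaus κ)ᵒᵖ ⥤ Type u}

theorem map_map_apply {K L M : CHaus κ} (f : K ⟶ L) (g : L ⟶ M) (φ : X.obj (op M)) :
    X.map f.op (X.map g.op φ) = X.map (f ≫ g).op φ := by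
  simp

theorem map_id_apply {K : CHaus κ} (φ : X.obj (op K)) : X.map (𝟙 K).op φ = φ := by
  simp

namespace IsCondensed

theorem map_injective (hX : IsCondensed κ X) {K L : CHaus κ} (f : K ⟶ L)
    (hf : Function.Surjective f.hom) :
    Function.Injective (X.map f.op) := by
  intro φ ψ h
  refine (hX.existsUnique f hf _ _ (CHaus.isPullback f f) (X.map f.op φ) ?_).unique rfl h.symm
  rw [map_map_apply, map_map_apply, CHaus.pullback_condition]

theorem exists_desc (hX : IsCondensed κ X) {K L : CHaus κ} (f : K ⟶ L)
    (hf : Function.Surjective f.hom)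
    (φ : X.obj (op K))
    (h : X.map (CHaus.pullbackFst f f).op φ = X.map (CHaus.pullbackSnd f f).op φ) :
    ∃ ψ : X.obj (op L), X.map f.op ψ = φ :=
  (hX.existsUnique f hf _ _ (CHaus.isPullback f f) φ h).exists

theorem existsUnique_sigma (hX : IsCondensed κ X) {J : Type u} [Finite J] (K : J → CHaus κ)
    (φ : ∀ j, X.obj (op (K j))) :
    ∃! ψ : X.obj (op (CHaus.sigma K)), ∀ j, X.map (CHaus.sigmaι K j).op ψ = φ j := by
  have := hX.preservesFiniteProducts
  have hl := isLimitOfPreserves X (Cofan.IsColimit.op (CHaus.isColimitSigma K))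
  obtain ⟨ψ, hψ, hu⟩ := (Types.isLimit_iff _).mp ⟨hl⟩ (fun j => φ j.as) (by
    rintro ⟨i⟩ ⟨j⟩ ⟨⟨h⟩⟩
    obtain rfl : i = j := h
    exact map_id_apply _)
  exact ⟨ψ, fun j => hψ ⟨j⟩, fun χ hχ => hu χ fun j => hχ j.as⟩

/-- The two sheaf conditions combine: the family is the surjection from its disjoint union. -/
theorem ext_of_jointly_surjective (hX : IsCondensed κ X) {J : Type u} [Finite J]
    {K : J → CHaus κ} {L : CHaus κ}
    (f : ∀ j, K j ⟶ L) (hf : ∀ l, ∃ j k, (f j).hom k = l) {φ ψ : X.obj (op L)}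
    (h : ∀ j, X.map (f j).op φ = X.map (f j).op ψ) : φ = ψ := by
  apply hX.map_injective (CHaus.sigmaDesc K f) fun l => by
    obtain ⟨j, k, hk⟩ := hf l
    exact ⟨⟨j, k⟩, hk⟩
  refine (hX.existsUnique_sigma K fun j => X.map (f j).op φ).unique ?_ ?_
  · intro j
    rw [map_map_apply, CHaus.sigmaι_desc]
  · intro j
    rw [map_map_apply, CHaus.sigmaι_desc, h]

end IsCondensed

/-- Reduces the sheaf conditions to the explicit coproducts and fibre products; any other kernel
pair receives a morphism from the explicit one. -/
theorem isCondensed_of_elementwise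
    (hs : ∀ (J : Type u) [Finite J] (K : J → CHaus κ) (φ : ∀ j, X.obj (op (K j))),
      ∃! ψ : X.obj (op (CHaus.sigma K)), ∀ j, X.map (CHaus.sigmaι K j).op ψ = φ j)
    (hi : ∀ ⦃K L : CHaus κ⦄ (f : K ⟶ L), Function.Surjective f.hom →
      Function.Injective (X.map f.op))
    (hd : ∀ ⦃K L : CHaus κ⦄ (f : K ⟶ L), Function.Surjective f.hom → ∀ φ : X.obj (op K),
      X.map (CHaus.pullbackFst f f).op φ = X.map (CHaus.pullbackSnd f f).op φ →
      ∃ ψ : X.obj (op L), X.map f.op ψ = φ) : IsCondensed κ X where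
  preservesFiniteProducts := by
    have key (J : Type u) [Finite J] : PreservesLimitsOfShape (Discrete J) X := by
      have (K : J → CHaus κ) : PreservesLimit (Discrete.functor fun j => op (K j)) X := by
        apply preservesLimit_of_preserves_limit_cone
          (Cofan.IsColimit.op (CHaus.isColimitSigma K))
        refine ((Types.isLimit_iff _).mpr fun s hs' => ?_).some
        obtain ⟨ψ, hψ, hu⟩ := hs J K fun j => s ⟨j⟩
        exact ⟨ψ, fun j => hψ j.as, fun χ hχ => hu χ fun j => hχ ⟨j⟩⟩
      refine ⟨fun {F} => ?_⟩
      have := this fun j => (F.obj ⟨j⟩).unop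
      exact preservesLimit_of_iso_diagram X
        (Discrete.natIso fun _ => Iso.refl _ :
          (Discrete.functor fun j => op (F.obj ⟨j⟩).unop) ≅ F)
    refine ⟨fun n => ?_⟩
    -- Finite products are indexed by `Fin n` in `Type`, the explicit coproducts by types in `Type
    -- u`.
    have := key (ULift.{u} (Fin n))
    exact preservesLimitsOfShape_of_equiv (Discrete.equivalence Equiv.ulift) X
  existsUnique K L f hf R π₁ π₂ hR φ hφ := by
    obtain ⟨ψ, hψ⟩ := hd f hf φ (by
      have h := CHaus.pullback_condition f f
      rw [← hR.lift_fst _ _ h, ← map_map_apply, hφ, map_map_apply, hR.lift_snd])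
    exact ⟨ψ, hψ, fun χ hχ => hi f hf (hχ.trans hψ.symm)⟩

end Presheaf

/-! ### Sheaves that are locally pulled back from spaces of bounded size -/

section Universal

variable {κ κ' : Size.{u}}

/-- Locally, every section of `Y` is pulled back from a space in `CHaus_κ`. -/
def IsLocallyBounded (h : κ ≤ κ') (Y : (CHaus κ')ᵒᵖ ⥤ Type u) : Prop :=
  ∀ (T : CHaus κ') (y : Y.obj (op T)), ∃ (T' : CHaus κ') (p : T' ⟶ T) (E : CHaus κ)
    (a : T' ⟶ (CHaus.incl h).obj E) (z : Y.obj (op ((CHaus.incl h).obj E))),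
    Function.Surjective p.hom ∧ Y.map p.op y = Y.map a.op z

variable {h : κ ≤ κ'} {Y W : (CHaus κ')ᵒᵖ ⥤ Type u}

/-- The pair (a, b) factors through its image F in E × E', which is κ-bounded. As T → F is
surjective, the sections z and z' already agree on F, where naturality of θ applies. -/
theorem map_eq_map_of_res (hY : IsCondensed κ' Y)
    (θ : (presheafRes h).obj Y ⟶ (presheafRes h).obj W) {T : CHaus κ'} {E E' : CHaus κ}
    (a : T ⟶ (CHaus.incl h).obj E) (b : T ⟶ (CHaus.incl h).obj E')
    (z : Y.obj (op ((CHaus.incl h).obj E))) (z' : Y.obj (op ((CHaus.incl h).obj E')))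
    (hz : Y.map a.op z = Y.map b.op z') :
    W.map a.op (θ.app (op E) z) = W.map b.op (θ.app (op E') z') := by
  let c : T ⟶ (CHaus.incl h).obj (CHaus.prod E E') :=
    CHaus.pair (K := (CHaus.incl h).obj E) (L := (CHaus.incl h).obj E') a b
  let F : CHaus κ := CHaus.ofClosed (CHaus.prod E E') (Set.range c.hom) (CHaus.isClosed_range c)
  let q : T ⟶ (CHaus.incl h).obj F := CHaus.toRange c
  let a' : F ⟶ E := CHaus.closedIncl _ _ _ ≫ CHaus.fst E E'
  let b' : F ⟶ E' := CHaus.closedIncl _ _ _ ≫ CHaus.snd E E'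
  have ha : q ≫ (CHaus.incl h).map a' = a := rfl
  have hb : q ≫ (CHaus.incl h).map b' = b := rfl
  have hF : Y.map ((CHaus.incl h).map a').op z = Y.map ((CHaus.incl h).map b').op z' := by
    apply hY.map_injective q (CHaus.toRange_surjective c)
    rw [map_map_apply, map_map_apply, ha, hb, hz]
  have na := NatTrans.naturality_apply θ a'.op z
  have nb := NatTrans.naturality_apply θ b'.op z'
  rw [← ha, ← hb, ← map_map_apply, ← map_map_apply]
  refine congrArg (W.map q.op) (na.symm.trans (Eq.trans ?_ nb))
  exact congrArg (θ.app (op F)) hF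

/-- The relation between sections of `Y` and of `W` generated by a natural transformation between
the restrictions to `CHaus_κ`. -/
def ResRel (θ : (presheafRes h).obj Y ⟶ (presheafRes h).obj W) {T : CHaus κ'}
    (y : Y.obj (op T)) (w : W.obj (op T)) : Prop :=
  ∃ (T' : CHaus κ') (p : T' ⟶ T) (E : CHaus κ) (a : T' ⟶ (CHaus.incl h).obj E)
    (z : Y.obj (op ((CHaus.incl h).obj E))), Function.Surjective p.hom ∧
    Y.map p.op y = Y.map a.op z ∧ W.map p.op w = W.map a.op (θ.app (op E) z)

/-- Both values are compared on the fibre product of the two surjections, where `map_eq_map_of_res`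
shows that they agree. -/
theorem ResRel.unique (hY : IsCondensed κ' Y) (hW : IsCondensed κ' W)
    {θ : (presheafRes h).obj Y ⟶ (presheafRes h).obj W} {T : CHaus κ'}
    {y : Y.obj (op T)} {w w' : W.obj (op T)} (hw : ResRel θ y w) (hw' : ResRel θ y w') :
    w = w' := by
  obtain ⟨T₁, p₁, E₁, a₁, z₁, hp₁, hy₁, hw₁⟩ := hw
  obtain ⟨T₂, p₂, E₂, a₂, z₂, hp₂, hy₂, hw₂⟩ := hw'
  have hc := CHaus.pullback_condition p₁ p₂
  apply hW.map_injective p₁ hp₁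
  apply hW.map_injective (CHaus.pullbackFst p₁ p₂) (CHaus.pullbackFst_surjective p₁ p₂ hp₂)
  rw [hw₁, map_map_apply (CHaus.pullbackFst p₁ p₂) p₁ w', hc, ← map_map_apply _ p₂, hw₂,
    map_map_apply, map_map_apply]
  apply map_eq_map_of_res hY
  rw [← map_map_apply, ← hy₁, ← map_map_apply, ← hy₂, map_map_apply, map_map_apply, hc]

/-- The value prescribed on T' descends to T: its two pullbacks to the kernel pair come from the
same section of Y, so `map_eq_map_of_res` identifies them. -/
theorem ResRel.exists (hY : IsCondensed κ' Y) (hW : IsCondensed κ' W)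
    (hb : IsLocallyBounded h Y)
    (θ : (presheafRes h).obj Y ⟶ (presheafRes h).obj W) {T : CHaus κ'}
    (y : Y.obj (op T)) : ∃ w, ResRel θ y w := by
  obtain ⟨T', p, E, a, z, hp, hy⟩ := hb T y
  obtain ⟨w, hw⟩ := hW.exists_desc p hp (W.map a.op (θ.app (op E) z)) (by
    rw [map_map_apply, map_map_apply]
    apply map_eq_map_of_res hY
    rw [← map_map_apply, ← map_map_apply, ← hy, map_map_apply, map_map_apply,
      CHaus.pullback_condition])
  exact ⟨w, T', p, E, a, z, hp, hy, hw⟩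

theorem ResRel.map {θ : (presheafRes h).obj Y ⟶ (presheafRes h).obj W} {S T : CHaus κ'}
    (g : S ⟶ T) {y : Y.obj (op T)} {w : W.obj (op T)} (hw : ResRel θ y w) :
    ResRel θ (Y.map g.op y) (W.map g.op w) := by
  obtain ⟨T', p, E, a, z, hp, hy, hw⟩ := hw
  refine ⟨_, CHaus.pullbackFst g p, E, CHaus.pullbackSnd g p ≫ a, z,
    CHaus.pullbackFst_surjective g p hp, ?_, ?_⟩
  · rw [map_map_apply, CHaus.pullback_condition, ← map_map_apply, hy, map_map_apply]
  · rw [map_map_apply, CHaus.pullback_condition, ← map_map_apply, hw, map_map_apply]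

theorem resRel_app (η : Y ⟶ W) (hb : IsLocallyBounded h Y) {T : CHaus κ'} (y : Y.obj (op T)) :
    ResRel ((presheafRes h).map η) y (η.app (op T) y) := by
  obtain ⟨T', p, E, a, z, hp, hy⟩ := hb T y
  refine ⟨T', p, E, a, z, hp, hy, ?_⟩
  have h₁ := NatTrans.naturality_apply η p.op y
  have h₂ := NatTrans.naturality_apply η a.op z
  exact h₁.symm.trans ((congrArg (η.app (op T')) hy).trans h₂)

theorem resRel_self (θ : (presheafRes h).obj Y ⟶ (presheafRes h).obj W) {E : CHaus κ}
    (y : Y.obj (op ((CHaus.incl h).obj E))) : ResRel θ y (θ.app (op E) y) :=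
  ⟨_, 𝟙 _, E, 𝟙 _, y, Function.surjective_id, rfl, rfl⟩

/-- A locally bounded sheaf is the value of the left adjoint of restriction at its restriction. -/
theorem isUniversalRes_of_isLocallyBounded (h : κ ≤ κ') {X : CondSet κ} {Y : CondSet κ'}
    (e : X.obj ≅ (presheafRes h).obj Y.obj) (hb : IsLocallyBounded h Y.obj) :
    IsUniversalRes h e.hom := by
  intro W
  constructor
  · intro η η' hη
    replace hη : (presheafRes h).map η.hom = (presheafRes h).map η'.hom :=
      (cancel_epi e.hom).mp hη
    refine ObjectProperty.hom_ext _ (NatTrans.ext (funext fun T => ?_))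
    refine ConcreteCategory.hom_ext _ _ fun y => ?_
    exact (resRel_app η.hom hb y).unique Y.property W.property (hη ▸ resRel_app η'.hom hb y)
  · intro θ'
    let θ : (presheafRes h).obj Y.obj ⟶ (presheafRes h).obj W.obj := e.inv ≫ θ'
    choose f hf using fun (T : CHaus κ') (y : Y.obj.obj (op T)) =>
      ResRel.exists Y.property W.property hb θ y
    let η : Y.obj ⟶ W.obj :=
      { app := fun T => TypeCat.ofHom (f T.unop)
        naturality := fun S T g => ConcreteCategory.hom_ext _ _ fun y =>
          (hf _ _).unique Y.property W.property ((hf S.unop y).map g.unop) }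
    refine ⟨ObjectProperty.homMk η, ?_⟩
    have hη : (presheafRes h).map η = θ := by
      refine NatTrans.ext (funext fun E => ConcreteCategory.hom_ext _ _ fun y => ?_)
      exact (hf _ _).unique Y.property W.property (resRel_self θ (E := E.unop) y)
    change e.hom ≫ (presheafRes h).map η = θ'
    rw [hη, Iso.hom_inv_id_assoc]

/-- The restriction of a `κ'`-condensed set to `CHaus_κ`. -/
theorem IsCondensed.res (h : κ ≤ κ') (hY : IsCondensed κ' Y) :
    IsCondensed κ ((presheafRes h).obj Y) :=
  isCondensed_of_elementwise
    (fun _ _ K φ => hY.existsUnique_sigma (fun j => (CHaus.incl h).obj (K j)) φ)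
    (fun _ _ f hf => hY.map_injective ((CHaus.incl h).map f) hf)
    (fun _ _ f hf φ hφ => hY.exists_desc ((CHaus.incl h).map f) hf φ hφ)

end Universal

/-- The required κ-condensed set is the restriction of `Y` itself, with the identity as universal
arrow. -/
theorem isSmallCondensed_of_isLocallyBounded {κ : Cardinal.{u}} {h₀ : Cardinal.aleph0 < κ}
    {h₁ : κ.IsStrongLimit} (Y : CondSet Size.all.{u})
    (hb : IsLocallyBounded (Size.le_all (Size.of κ h₀ h₁)) Y.obj) : IsSmallCondensed Y :=
  ⟨κ, h₀, h₁, ⟨_, Y.property.res (Size.le_all _)⟩, 𝟙 _,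
    isUniversalRes_of_isLocallyBounded (X := ⟨_, Y.property.res (Size.le_all _)⟩)
      (Size.le_all _) (Iso.refl _) hb⟩

/-! ### Two copies of a compact space, glued along an ideal of subsets -/

theorem Order.Ideal.iUnion_mem {α : Type*} (N : Order.Ideal (Set α)) {J : Type*} [Finite J]
    {s : J → Set α} (hs : ∀ j, s j ∈ N) : ⋃ j, s j ∈ N := by
  have := Fintype.ofFinite J
  have := (N.finsetSup_mem_iff (s := Finset.univ) (f := s)).mpr fun j _ => hs j
  rwa [Finset.sup_univ_eq_iSup] at this

section Glue

variable {κ : Size.{u}} {E : CHaus κ} (N : Order.Ideal (Set E.obj))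

/-- A morphism `T ⟶ E` together with a closed cover of `T` by two sets on whose intersection it is
small with respect to the ideal `N`. -/
structure GlueDatum (T : CHaus κ) where
  map : T ⟶ E
  left : Set T.obj
  right : Set T.obj
  isClosed_left : IsClosed left
  isClosed_right : IsClosed right
  cover : ∀ t, t ∈ left ∨ t ∈ right
  small : map.hom '' (left ∩ right) ∈ N

namespace GlueDatum

variable {N} {S T : CHaus κ}

/-- Two data are equivalent if they have the same underlying morphism, and it is small where the
two covers disagree. -/
structure Rel (a b : GlueDatum N T) : Prop where
  map_eq : a.map = b.map
  left_right : a.map.hom '' (a.left ∩ b.right) ∈ N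
  right_left : a.map.hom '' (b.left ∩ a.right) ∈ N

instance setoid (N : Order.Ideal (Set E.obj)) (T : CHaus κ) : Setoid (GlueDatum N T) where
  r := Rel
  iseqv :=
    { refl := fun a => ⟨rfl, a.small, a.small⟩
      symm := fun {a b} h => ⟨h.map_eq.symm, h.map_eq ▸ h.right_left, h.map_eq ▸ h.left_right⟩
      trans := fun {a b c} h h' => by
        have hl := h'.left_right
        have hr := h'.right_left
        rw [← h.map_eq] at hl hr
        refine ⟨h.map_eq.trans h'.map_eq, N.lower ?_ (N.sup_mem h.left_right hl),
          N.lower ?_ (N.sup_mem h.right_left hr)⟩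
        -- Each such point lies in one of the two halves of `b`, so the disagreement of `a` and `c`
        -- is contained in the union of the two given disagreements.
        · rintro _ ⟨t, ⟨ha, hc⟩, rfl⟩
          exact (b.cover t).elim (fun hb => Or.inr ⟨t, ⟨hb, hc⟩, rfl⟩)
            fun hb => Or.inl ⟨t, ⟨ha, hb⟩, rfl⟩
        · rintro _ ⟨t, ⟨hc, ha⟩, rfl⟩
          exact (b.cover t).elim (fun hb => Or.inl ⟨t, ⟨hb, ha⟩, rfl⟩)
            fun hb => Or.inr ⟨t, ⟨hc, hb⟩, rfl⟩ }

/-- Pullback of a datum along a morphism. -/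
def comap (g : S ⟶ T) (a : GlueDatum N T) : GlueDatum N S where
  map := g ≫ a.map
  left := g.hom ⁻¹' a.left
  right := g.hom ⁻¹' a.right
  isClosed_left := a.isClosed_left.preimage (CHaus.continuous_hom g)
  isClosed_right := a.isClosed_right.preimage (CHaus.continuous_hom g)
  cover s := a.cover (g.hom s)
  small := N.lower (by rintro _ ⟨s, hs, rfl⟩; exact ⟨g.hom s, hs, rfl⟩) a.small

theorem Rel.comap (g : S ⟶ T) {a b : GlueDatum N T} (h : Rel a b) :
    Rel (a.comap g) (b.comap g) where
  map_eq := congrArg (g ≫ ·) h.map_eq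
  left_right := N.lower (by rintro _ ⟨s, hs, rfl⟩; exact ⟨g.hom s, hs, rfl⟩) h.left_right
  right_left := N.lower (by rintro _ ⟨s, hs, rfl⟩; exact ⟨g.hom s, hs, rfl⟩) h.right_left

/-- Equivalence of data can be checked on a finite jointly surjective family. -/
theorem Rel.of_jointly_surjective {J : Type u} [Finite J] {K : J → CHaus κ}
    (f : ∀ j, K j ⟶ T) (hf : ∀ t, ∃ j k, (f j).hom k = t) {a b : GlueDatum N T}
    (h : ∀ j, Rel (a.comap (f j)) (b.comap (f j))) : Rel a b where
  map_eq := CHaus.hom_ext fun t => by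
    obtain ⟨j, k, rfl⟩ := hf t
    exact congrArg (fun g : K j ⟶ E => g.hom k) (h j).map_eq
  left_right := N.lower (by
    rintro _ ⟨t, ht, rfl⟩
    obtain ⟨j, k, rfl⟩ := hf t
    exact Set.mem_iUnion.mpr ⟨j, k, ht, rfl⟩) (N.iUnion_mem fun j => (h j).left_right)
  right_left := N.lower (by
    rintro _ ⟨t, ht, rfl⟩
    obtain ⟨j, k, rfl⟩ := hf t
    exact Set.mem_iUnion.mpr ⟨j, k, ht, rfl⟩) (N.iUnion_mem fun j => (h j).right_left)

/-- The datum on a finite coproduct with given components. -/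
def sigma {J : Type u} [Finite J] {K : J → CHaus κ} (a : ∀ j, GlueDatum N (K j)) :
    GlueDatum N (CHaus.sigma K) where
  map := CHaus.sigmaDesc K fun j => (a j).map
  left := {x : Σ j, (K j).obj | x.2 ∈ (a x.1).left}
  right := {x : Σ j, (K j).obj | x.2 ∈ (a x.1).right}
  isClosed_left := isClosed_sigma_iff.mpr fun j => (a j).isClosed_left
  isClosed_right := isClosed_sigma_iff.mpr fun j => (a j).isClosed_right
  cover x := (a x.1).cover x.2
  small := N.lower (by
    rintro _ ⟨⟨j, k⟩, hk, rfl⟩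
    exact Set.mem_iUnion.mpr ⟨j, k, hk, rfl⟩) (N.iUnion_mem fun j => (a j).small)

/-- Descent of a datum along a surjection. -/
theorem exists_desc (f : S ⟶ T) (hf : Function.Surjective f.hom) (a : GlueDatum N S)
    (h : Rel (a.comap (CHaus.pullbackFst f f)) (a.comap (CHaus.pullbackSnd f f))) :
    ∃ b : GlueDatum N T, Rel (b.comap f) a := by
  obtain ⟨t, ht⟩ := (isCondensed_yoneda E).exists_desc f hf a.map h.map_eq
  change f ≫ t = a.map at ht
  have hcl := (CHaus.continuous_hom f).isClosedMap
  -- The descended cover consists of the images of the two halves. Where these overlap there are x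
  -- in the left half and y in the right half with f x = f y; then (x, y) is a point of the kernel
  -- pair, where the hypothesis `h` controls the image in E.
  have key : ∀ x ∈ a.left, ∀ y ∈ a.right, f.hom x = f.hom y →
      t.hom (f.hom x) ∈ (a.comap (CHaus.pullbackFst f f)).map.hom ''
        ((a.comap (CHaus.pullbackFst f f)).left ∩ (a.comap (CHaus.pullbackSnd f f)).right) :=
    fun x hx y hy hxy =>
      ⟨⟨(x, y), hxy⟩, ⟨hx, hy⟩, congrArg (fun g : S ⟶ E => g.hom x) ht.symm⟩
  refine ⟨⟨t, f.hom '' a.left, f.hom '' a.right, hcl _ a.isClosed_left, hcl _ a.isClosed_right,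
    fun l => ?_, N.lower ?_ h.left_right⟩, ht, N.lower ?_ h.left_right, N.lower ?_ h.left_right⟩
  · obtain ⟨s, rfl⟩ := hf l
    exact (a.cover s).imp (fun hs => ⟨s, hs, rfl⟩) fun hs => ⟨s, hs, rfl⟩
  · rintro _ ⟨l, ⟨⟨x, hx, rfl⟩, ⟨y, hy, hxy⟩⟩, rfl⟩
    exact key x hx y hy hxy.symm
  · rintro _ ⟨y, ⟨⟨x, hx, hxy⟩, hy⟩, rfl⟩
    change t.hom (f.hom y) ∈ _
    rw [← hxy]
    exact key x hx y hy hxy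
  · rintro _ ⟨x, ⟨hx, ⟨y, hy, hxy⟩⟩, rfl⟩
    exact key x hx y hy hxy.symm

variable (N) in
/-- The datum given by a morphism and the trivial cover by the left half. -/
def inl (f : T ⟶ E) : GlueDatum N T where
  map := f
  left := Set.univ
  right := ∅
  isClosed_left := isClosed_univ
  isClosed_right := isClosed_empty
  cover _ := Or.inl trivial
  small := by simpa using N.bot_mem

variable (N) in
/-- The datum given by a morphism and the trivial cover by the right half. -/
def inr (f : T ⟶ E) : GlueDatum N T where
  map := f
  left := ∅
  right := Set.univ
  isClosed_left := isClosed_empty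
  isClosed_right := isClosed_univ
  cover _ := Or.inr trivial
  small := by simpa using N.bot_mem

/-- The property for which the gluing is made: a map equalises the two inclusions exactly when its
image lies in the ideal. -/
theorem rel_inl_inr_iff (f : T ⟶ E) : Rel (inl N f) (inr N f) ↔ Set.range f.hom ∈ N := by
  refine ⟨fun h => N.lower ?_ h.left_right,
    fun h => ⟨rfl, N.lower (Set.image_subset_range _ _) h, N.lower (Set.image_subset_range _ _) h⟩⟩
  rintro _ ⟨t, rfl⟩
  exact ⟨t, ⟨trivial, trivial⟩, rfl⟩

end GlueDatum

/-- The presheaf obtained by gluing two copies of `Hom(-, E)` along the subsheaf of those maps whose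
image lies in the ideal `N`. -/
def gluePresheaf : (CHaus κ)ᵒᵖ ⥤ Type u where
  obj T := Quotient (GlueDatum.setoid N T.unop)
  map g := TypeCat.ofHom (Quotient.map (GlueDatum.comap g.unop) fun _ _ h => h.comap g.unop)
  map_id _ := ConcreteCategory.hom_ext _ _ (by rintro ⟨a⟩; rfl)
  map_comp _ _ := ConcreteCategory.hom_ext _ _ (by rintro ⟨a⟩; rfl)

/-- The section of the glued presheaf given by a datum. -/
def GlueDatum.toSection {N : Order.Ideal (Set E.obj)} {T : CHaus κ} (a : GlueDatum N T) :
    (gluePresheaf N).obj (op T) :=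
  Quotient.mk _ a

theorem GlueDatum.toSection_eq_iff {N : Order.Ideal (Set E.obj)} {T : CHaus κ}
    {a b : GlueDatum N T} : a.toSection = b.toSection ↔ Rel a b :=
  Quotient.eq

theorem GlueDatum.exists_toSection {N : Order.Ideal (Set E.obj)} {T : CHaus κ}
    (x : (gluePresheaf N).obj (op T)) : ∃ a : GlueDatum N T, a.toSection = x :=
  Quotient.exists_rep x

theorem isCondensed_gluePresheaf : IsCondensed κ (gluePresheaf N) := by
  -- Separatedness for finite jointly surjective families serves both for uniqueness on coproducts
  -- and for injectivity along surjections.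
  have hext {J : Type u} [Finite J] {K : J → CHaus κ} {T : CHaus κ} (f : ∀ j, K j ⟶ T)
      (hf : ∀ t, ∃ j k, (f j).hom k = t) (x y : (gluePresheaf N).obj (op T))
      (h : ∀ j, (gluePresheaf N).map (f j).op x = (gluePresheaf N).map (f j).op y) : x = y := by
    obtain ⟨a, rfl⟩ := GlueDatum.exists_toSection x
    obtain ⟨b, rfl⟩ := GlueDatum.exists_toSection y
    refine GlueDatum.toSection_eq_iff.mpr (.of_jointly_surjective f hf fun j => ?_)
    exact GlueDatum.toSection_eq_iff.mp (h j)
  refine isCondensed_of_elementwise ?_ ?_ ?_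
  · intro J _ K φ
    choose a ha using fun j => GlueDatum.exists_toSection (φ j)
    have hψ : ∀ j, (gluePresheaf N).map (CHaus.sigmaι K j).op (GlueDatum.sigma a).toSection =
        φ j := fun j => ha j
    refine ⟨(GlueDatum.sigma a).toSection, hψ, fun χ hχ => ?_⟩
    exact hext (CHaus.sigmaι K) (fun t => ⟨t.1, t.2, rfl⟩) _ _ fun j => (hχ j).trans (hψ j).symm
  · intro K L f hf x y h
    exact hext (fun _ : PUnit => f) (fun t => ⟨⟨⟩, hf t⟩) x y fun _ => h
  · intro K L f hf φ hφ
    obtain ⟨a, rfl⟩ := GlueDatum.exists_toSection φ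
    obtain ⟨b, hb⟩ := a.exists_desc f hf (GlueDatum.toSection_eq_iff.mp hφ)
    exact ⟨b.toSection, GlueDatum.toSection_eq_iff.mpr hb⟩

/-- Two copies of `Hom(-, E)` glued along an ideal, as a condensed set. -/
abbrev glueCondSet : CondSet κ := ⟨gluePresheaf N, isCondensed_gluePresheaf N⟩

end Glue

/-- After passage from T to the disjoint union of the two closed halves, a datum becomes the
pullback of the tautological section over E ⊔ E, which is the left inclusion on one copy and the
right inclusion on the other. -/
theorem isLocallyBounded_gluePresheaf {κ κ' : Size.{u}} (h : κ ≤ κ') (E : CHaus κ)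
    (N : Order.Ideal (Set ((CHaus.incl h).obj E).obj)) :
    IsLocallyBounded h (gluePresheaf N) := by
  intro T x
  obtain ⟨a, rfl⟩ := GlueDatum.exists_toSection x
  let A : ULift.{u} Bool → CHaus κ' := fun b =>
    CHaus.ofClosed T (if b.down then a.left else a.right)
      (by split_ifs <;> [exact a.isClosed_left; exact a.isClosed_right])
  let i : ∀ b, A b ⟶ T := fun b => CHaus.closedIncl T _ _
  let E₂ : CHaus κ := CHaus.sigma fun _ : ULift.{u} Bool => E
  let c : CHaus.sigma A ⟶ (CHaus.incl h).obj E₂ :=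
    CHaus.sigmaDesc A fun b => i b ≫ a.map ≫
      CHaus.sigmaι (fun _ : ULift.{u} Bool => (CHaus.incl h).obj E) b
  let z : GlueDatum N ((CHaus.incl h).obj E₂) :=
    GlueDatum.sigma (K := fun _ : ULift.{u} Bool => (CHaus.incl h).obj E) fun b =>
      if b.down then GlueDatum.inl N (𝟙 _) else GlueDatum.inr N (𝟙 _)
  refine ⟨_, CHaus.sigmaDesc A i, E₂, c, z.toSection, ?_, ?_⟩
  · intro t
    rcases a.cover t with ht | ht
    · exact ⟨⟨⟨true⟩, ⟨t, ht⟩⟩, rfl⟩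
    · exact ⟨⟨⟨false⟩, ⟨t, ht⟩⟩, rfl⟩
  · refine GlueDatum.toSection_eq_iff.mpr ⟨?_, N.lower ?_ a.small, N.lower ?_ a.small⟩
    · refine CHaus.hom_ext ?_
      rintro ⟨⟨_ | _⟩, t⟩ <;> rfl
    · rintro _ ⟨⟨⟨_ | _⟩, t⟩, ⟨h₁, h₂⟩, rfl⟩
      · exact ⟨t.1, ⟨h₁, t.2⟩, rfl⟩
      · exact h₂.elim
    · rintro _ ⟨⟨⟨_ | _⟩, t⟩, ⟨h₁, h₂⟩, rfl⟩
      · exact h₁.elim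
      · exact ⟨t.1, ⟨t.2, h₂⟩, rfl⟩

/-! ### Fibre products of representables -/

section Fibre

variable {κ : Size.{u}} {X : (CHaus κ)ᵒᵖ ⥤ Type u} {K : CHaus κ}

/-- The fibre product of the morphisms `Hom(-, K) ⟶ X` corresponding to two sections over `K`. -/
def fibrePresheaf (φ ψ : X.obj (op K)) : (CHaus κ)ᵒᵖ ⥤ Type u where
  obj T := {c : (T.unop ⟶ K) × (T.unop ⟶ K) // X.map c.1.op φ = X.map c.2.op ψ}
  map g := TypeCat.ofHom fun c => ⟨(g.unop ≫ c.1.1, g.unop ≫ c.1.2), by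
    rw [← map_map_apply, ← map_map_apply, c.2]⟩
  map_id _ := rfl
  map_comp _ _ := rfl

theorem isCondensed_fibrePresheaf (hX : IsCondensed κ X) (φ ψ : X.obj (op K)) :
    IsCondensed κ (fibrePresheaf φ ψ) := by
  refine isCondensed_of_elementwise ?_ ?_ ?_
  · intro J _ L c
    refine ⟨⟨(CHaus.sigmaDesc L fun j => (c j).1.1, CHaus.sigmaDesc L fun j => (c j).1.2), ?_⟩,
      fun j => rfl, fun d hd => Subtype.ext (Prod.ext ?_ ?_)⟩
    · refine hX.ext_of_jointly_surjective (CHaus.sigmaι L) (fun t => ⟨t.1, t.2, rfl⟩) fun j => ?_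
      rw [map_map_apply, map_map_apply]
      exact (c j).2
    · refine CHaus.hom_ext fun t => ?_
      exact congrArg (fun b => b.1.1.hom t.2) (hd t.1)
    · refine CHaus.hom_ext fun t => ?_
      exact congrArg (fun b => b.1.2.hom t.2) (hd t.1)
  · intro L M f hf c d h
    have h₁ : f ≫ c.1.1 = f ≫ d.1.1 := congrArg (fun b => b.1.1) h
    have h₂ : f ≫ c.1.2 = f ≫ d.1.2 := congrArg (fun b => b.1.2) h
    exact Subtype.ext (Prod.ext ((isCondensed_yoneda K).map_injective f hf h₁)
      ((isCondensed_yoneda K).map_injective f hf h₂))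
  · intro L M f hf c h
    obtain ⟨a, ha⟩ := (isCondensed_yoneda K).exists_desc f hf c.1.1
      (congrArg (fun b => b.1.1) h)
    obtain ⟨b, hb⟩ := (isCondensed_yoneda K).exists_desc f hf c.1.2
      (congrArg (fun b => b.1.2) h)
    change f ≫ a = _ at ha
    change f ≫ b = _ at hb
    refine ⟨⟨(a, b), ?_⟩, Subtype.ext (Prod.ext ha hb)⟩
    apply hX.map_injective f hf
    rw [map_map_apply, map_map_apply, ha, hb, c.2]

/-- The fibre product of two morphisms `Hom(-, K) ⟶ X` as a condensed set. -/
abbrev fibreCondSet (hX : IsCondensed κ X) (φ ψ : X.obj (op K)) : CondSet κ :=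
  ⟨fibrePresheaf φ ψ, isCondensed_fibrePresheaf hX φ ψ⟩

/-- If two sections have the same pullbacks to `T`, then they have the same pullbacks to the image
of `T`. -/
theorem IsCondensed.map_range_eq (hX : IsCondensed κ X) {L T : CHaus κ} {φ : X.obj (op K)}
    {ψ : X.obj (op L)} (a : T ⟶ K) (b : T ⟶ L) (h : X.map a.op φ = X.map b.op ψ) :
    X.map (CHaus.closedIncl (CHaus.prod K L) _ (CHaus.isClosed_range (CHaus.pair a b)) ≫
        CHaus.fst K L).op φ =
      X.map (CHaus.closedIncl (CHaus.prod K L) _ (CHaus.isClosed_range (CHaus.pair a b)) ≫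
        CHaus.snd K L).op ψ := by
  apply hX.map_injective _ (CHaus.toRange_surjective (CHaus.pair a b))
  rw [map_map_apply, map_map_apply]
  exact h

end Fibre

/-- A pair of maps T → K factors through its image in K × K, and by descent the relation between φ
and ψ already holds there. -/
theorem isLocallyBounded_fibrePresheaf {κ κ' : Size.{u}} (h : κ ≤ κ')
    {X : (CHaus κ')ᵒᵖ ⥤ Type u} (hX : IsCondensed κ' X) (K : CHaus κ)
    (φ ψ : X.obj (op ((CHaus.incl h).obj K))) : IsLocallyBounded h (fibrePresheaf φ ψ) := by
  intro T c
  obtain ⟨⟨a, b⟩, hab⟩ := c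
  let E : CHaus κ := CHaus.ofClosed (CHaus.prod K K)
    (Set.range (CHaus.pair a b).hom) (CHaus.isClosed_range (CHaus.pair a b))
  let a' : E ⟶ K := CHaus.closedIncl _ _ _ ≫ CHaus.fst K K
  let b' : E ⟶ K := CHaus.closedIncl _ _ _ ≫ CHaus.snd K K
  have hz : X.map ((CHaus.incl h).map a').op φ = X.map ((CHaus.incl h).map b').op ψ :=
    hX.map_range_eq a b hab
  refine ⟨T, 𝟙 T, E, CHaus.toRange (CHaus.pair a b),
    ⟨((CHaus.incl h).map a', (CHaus.incl h).map b'), hz⟩, Function.surjective_id, ?_⟩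
  exact Subtype.ext (Prod.ext (Category.id_comp a) (Category.id_comp b))

/-! ### Closed coincidence -/

section Coincidence

variable {κ : Size.{u}} {X : (CHaus κ)ᵒᵖ ⥤ Type u}

/-- The points at which two sections coincide form a closed subset of the product, and the sections
agree on this subset. -/
def CoincideOnClosed {K L : CHaus κ} (φ : X.obj (op K)) (ψ : X.obj (op L)) : Prop :=
  ∃ (A : Set (CHaus.prod K L).obj) (hA : IsClosed A),
    (∀ k l, pointMap X φ k = pointMap X ψ l → (k, l) ∈ A) ∧
    X.map (CHaus.closedIncl (CHaus.prod K L) A hA ≫ CHaus.fst K L).op φ =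
      X.map (CHaus.closedIncl (CHaus.prod K L) A hA ≫ CHaus.snd K L).op ψ

variable (X) in
/-- Any two sections coincide on a closed subset. -/
def HasClosedCoincidence : Prop :=
  ∀ ⦃K L : CHaus κ⦄ (φ : X.obj (op K)) (ψ : X.obj (op L)), CoincideOnClosed φ ψ

theorem pointMap_map {K L : CHaus κ} (f : K ⟶ L) (φ : X.obj (op L)) (k : K.obj) :
    pointMap X (X.map f.op φ) k = pointMap X φ (f.hom k) := by
  rw [pointMap, map_map_apply, CHaus.const_comp, pointMap]

theorem pointMap_app {Y : (CHaus κ)ᵒᵖ ⥤ Type u} (η : X ⟶ Y) {K : CHaus κ} (φ : X.obj (op K))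
    (k : K.obj) : pointMap Y (η.app (op K) φ) k = η.app (op (CHaus.pt κ)) (pointMap X φ k) :=
  (NatTrans.naturality_apply η (CHaus.const K k).op φ).symm

theorem CoincideOnClosed.map {K L K' L' : CHaus κ} {φ : X.obj (op K)} {ψ : X.obj (op L)}
    (h : CoincideOnClosed φ ψ) (f : K' ⟶ K) (g : L' ⟶ L) :
    CoincideOnClosed (X.map f.op φ) (X.map g.op ψ) := by
  obtain ⟨A, hA, hA', he⟩ := h
  let c : CHaus.prod K' L' ⟶ CHaus.prod K L :=
    CHaus.pair (CHaus.fst K' L' ≫ f) (CHaus.snd K' L' ≫ g)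
  refine ⟨c.hom ⁻¹' A, hA.preimage (CHaus.continuous_hom c), fun k l hkl => ?_, ?_⟩
  · rw [pointMap_map, pointMap_map] at hkl
    exact hA' _ _ hkl
  · have he' := congrArg (X.map (CHaus.closedLift A hA
      (CHaus.closedIncl _ _ (hA.preimage (CHaus.continuous_hom c)) ≫ c) fun x => x.2).op) he
    rw [map_map_apply, map_map_apply] at he'
    rw [map_map_apply, map_map_apply]
    exact he'

/-- Two sections are pullbacks of a section over a space covered by two subspaces. -/
theorem IsCondensed.exists_union (hX : IsCondensed κ X) {K L : CHaus κ} (φ : X.obj (op K))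
    (ψ : X.obj (op L)) : ∃ (M : CHaus κ) (f : K ⟶ M) (g : L ⟶ M) (χ : X.obj (op M)),
      X.map f.op χ = φ ∧ X.map g.op χ = ψ := by
  let F : ULift.{u} Bool → CHaus κ := fun b => Bool.rec L K b.down
  let φ' : ∀ b, X.obj (op (F b)) := fun b => match b with
    | ⟨true⟩ => φ
    | ⟨false⟩ => ψ
  obtain ⟨χ, hχ, -⟩ := hX.existsUnique_sigma F φ'
  exact ⟨_, CHaus.sigmaι F ⟨true⟩, CHaus.sigmaι F ⟨false⟩, χ, hχ _, hχ _⟩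

/-- Quasiseparatedness only concerns pairs over a single K. Two sections over different spaces are
restrictions of one section over the disjoint union. -/
theorem HasClosedCoincidence.of_self (hX : IsCondensed κ X)
    (h : ∀ (K : CHaus κ) (φ : X.obj (op K)), CoincideOnClosed φ φ) : HasClosedCoincidence X := by
  intro K L φ ψ
  obtain ⟨M, f, g, χ, rfl, rfl⟩ := hX.exists_union φ ψ
  exact (h M χ).map f g

end Coincidence

/-! ### Quasiseparated objects -/

theorem CondSet.hom_inv_app_apply {κ : Size.{u}} {X Y : CondSet κ} (e : X ≅ Y) {T : (CHaus κ)ᵒᵖ}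
    (x : X.obj.obj T) : e.inv.hom.app T (e.hom.hom.app T x) = x := by
  have h : e.hom.hom ≫ e.inv.hom = 𝟙 _ := congrArg (fun f => f.hom) e.hom_inv_id
  exact ConcreteCategory.congr_hom (NatTrans.congr_app h T) x

theorem CondSet.inv_hom_app_apply {κ : Size.{u}} {X Y : CondSet κ} (e : X ≅ Y) {T : (CHaus κ)ᵒᵖ}
    (x : Y.obj.obj T) : e.hom.hom.app T (e.inv.hom.app T x) = x :=
  CondSet.hom_inv_app_apply e.symm x

/-- A category `𝒟` with a functor `y` from `CHaus_κ`, embedded as a full subcategory of `Cond_κ`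
compatibly with the Yoneda embedding and containing sufficiently many objects. -/
structure CondEmbedding {κ : Size.{u}} {𝒟 : Type w} [Category.{v} 𝒟] (y : CHaus κ ⥤ 𝒟) where
  functor : 𝒟 ⥤ CondSet κ
  fullyFaithful : functor.FullyFaithful
  iso : y ⋙ functor ≅ CondSet.rep κ
  glue_mem : ∀ (E : CHaus κ) (N : Order.Ideal (Set E.obj)), functor.essImage (glueCondSet N)
  fibre_mem : ∀ (X : 𝒟) (K : CHaus κ) (φ ψ : (functor.obj X).obj.obj (op K)),
    functor.essImage (fibreCondSet (functor.obj X).property φ ψ)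

namespace CondEmbedding

variable {κ : Size.{u}} {𝒟 : Type w} [Category.{v} 𝒟] {y : CHaus κ ⥤ 𝒟} (S : CondEmbedding y)

/-- The presheaf underlying an object. -/
abbrev psh (X : 𝒟) : (CHaus κ)ᵒᵖ ⥤ Type u := (S.functor.obj X).obj

/-- The natural transformation underlying a morphism. -/
abbrev pshMap {X Y : 𝒟} (f : X ⟶ Y) : S.psh X ⟶ S.psh Y := (S.functor.map f).hom

/-- The section corresponding to a morphism from a representable. -/
def sec {K : CHaus κ} {X : 𝒟} (f : y.obj K ⟶ X) : (S.psh X).obj (op K) :=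
  yonedaEquiv (X := K) (F := S.psh X) (S.iso.inv.app K ≫ S.functor.map f).hom

theorem sec_injective {K : CHaus κ} {X : 𝒟} :
    Function.Injective (S.sec : (y.obj K ⟶ X) → _) := by
  intro f g h
  apply S.fullyFaithful.map_injective
  rw [← cancel_epi (S.iso.inv.app K)]
  exact ObjectProperty.hom_ext _ (yonedaEquiv.injective h)

theorem sec_surjective {K : CHaus κ} {X : 𝒟} :
    Function.Surjective (S.sec : (y.obj K ⟶ X) → _) := by
  intro s
  let θ : (CondSet.rep κ).obj K ⟶ S.functor.obj X :=
    ObjectProperty.homMk (yonedaEquiv (X := K) (F := S.psh X) |>.symm s)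
  refine ⟨S.fullyFaithful.preimage (S.iso.hom.app K ≫ θ), ?_⟩
  rw [sec, S.fullyFaithful.map_preimage, Iso.inv_hom_id_app_assoc]
  exact Equiv.apply_symm_apply _ _

theorem sec_comp {K : CHaus κ} {X Y : 𝒟} (f : y.obj K ⟶ X) (g : X ⟶ Y) :
    S.sec (f ≫ g) = (S.pshMap g).app (op K) (S.sec f) := by
  rw [sec, Functor.map_comp, ← Category.assoc]
  exact yonedaEquiv_comp _ _

theorem sec_map {K L : CHaus κ} {X : 𝒟} (g : L ⟶ K) (f : y.obj K ⟶ X) :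
    S.sec (y.map g ≫ f) = (S.psh X).map g.op (S.sec f) := by
  have h : S.iso.inv.app L ≫ S.functor.map (y.map g ≫ f) =
      (CondSet.rep κ).map g ≫ S.iso.inv.app K ≫ S.functor.map f := by
    rw [Functor.map_comp, ← Category.assoc, ← Category.assoc]
    congr 1
    exact (S.iso.inv.naturality g).symm
  rw [sec, h]
  exact (yonedaEquiv_naturality (X := K) (F := S.psh X) _ g).symm

theorem sec_of_map {K L : CHaus κ} (g : L ⟶ K) :
    S.sec (y.map g) = (S.iso.inv.app K).hom.app (op L) g := by
  have h : S.iso.inv.app L ≫ S.functor.map (y.map g) =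
      (CondSet.rep κ).map g ≫ S.iso.inv.app K :=
    (S.iso.inv.naturality g).symm
  rw [sec, h]
  exact congrArg ((S.iso.inv.app K).hom.app (op L)) (Category.id_comp g)

/-- Morphisms are determined on the representables, by Yoneda and full faithfulness. -/
theorem hom_ext (S : CondEmbedding y) {X Y : 𝒟} {g h : X ⟶ Y}
    (H : ∀ (K : CHaus κ) (f : y.obj K ⟶ X), f ≫ g = f ≫ h) : g = h := by
  apply S.fullyFaithful.map_injective
  refine ObjectProperty.hom_ext _ (NatTrans.ext (funext fun K => ?_))
  refine ConcreteCategory.hom_ext _ _ fun x => ?_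
  obtain ⟨f, rfl⟩ := S.sec_surjective (K := K.unop) x
  have := congrArg S.sec (H _ f)
  rwa [sec_comp, sec_comp] at this

theorem map_surjective (S : CondEmbedding y) {K L : CHaus κ} :
    Function.Surjective (y.map : (K ⟶ L) → _) := by
  have : S.functor.Faithful := S.fullyFaithful.faithful
  have : (CondSet.rep κ).Full := inferInstanceAs (ObjectProperty.lift _ _ _).Full
  exact (Functor.Full.of_comp_faithful_iso S.iso).map_surjective

theorem map_injective (S : CondEmbedding y) {K L : CHaus κ} :
    Function.Injective (y.map : (K ⟶ L) → _) := by
  have : (CondSet.rep κ).Faithful := inferInstanceAs (ObjectProperty.lift _ _ _).Faithful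
  have : (y ⋙ S.functor).Faithful := Functor.Faithful.of_iso S.iso.symm
  exact (Functor.Faithful.of_comp y S.functor).map_injective

/-- A square is cartesian if it is so on points with values in representables. -/
theorem isPullback_of_points (S : CondEmbedding y) {Z A B X : 𝒟} {p : Z ⟶ A} {q : Z ⟶ B}
    {f : A ⟶ X} {g : B ⟶ X} (w : p ≫ f = q ≫ g)
    (hinj : ∀ (T : CHaus κ) (z z' : y.obj T ⟶ Z), z ≫ p = z' ≫ p → z ≫ q = z' ≫ q → z = z')
    (hex : ∀ (T : CHaus κ) (a : y.obj T ⟶ A) (b : y.obj T ⟶ B), a ≫ f = b ≫ g →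
      ∃ z : y.obj T ⟶ Z, z ≫ p = a ∧ z ≫ q = b) : IsPullback p q f g := by
  have := S.fullyFaithful.full
  have := S.fullyFaithful.faithful
  -- Fully faithful functors reflect pullbacks, so the square may be tested in presheaves, and there
  -- objectwise.
  refine IsPullback.of_map S.functor w (IsPullback.of_map (ObjectProperty.ι _) ?_ ?_)
  · rw [← Functor.map_comp, ← Functor.map_comp, w]
  refine IsPullback.of_forall_isPullback_app fun T =>
    (Types.isPullback_iff _ _ _ _).mpr ⟨?_, ?_, ?_⟩
  · have := congrArg (fun h => (S.pshMap h).app T) w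
    dsimp only [pshMap] at this
    rw [Functor.map_comp, Functor.map_comp] at this
    exact this
  · rintro x x' ⟨h₁, h₂⟩
    obtain ⟨z, rfl⟩ := S.sec_surjective (K := T.unop) x
    obtain ⟨z', rfl⟩ := S.sec_surjective (K := T.unop) x'
    refine congrArg _ (hinj _ z z' (S.sec_injective ?_) (S.sec_injective ?_))
    · rw [sec_comp, sec_comp]
      exact h₁
    · rw [sec_comp, sec_comp]
      exact h₂
  · intro a b hab
    obtain ⟨a, rfl⟩ := S.sec_surjective (K := T.unop) a
    obtain ⟨b, rfl⟩ := S.sec_surjective (K := T.unop) b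
    obtain ⟨z, rfl, rfl⟩ := hex _ a b (S.sec_injective (by
      rw [sec_comp, sec_comp]
      exact hab))
    exact ⟨S.sec z, (S.sec_comp z p).symm, (S.sec_comp z q).symm⟩

/-- A finite jointly surjective family is a covering. -/
theorem isCovering_of_jointly_surjective (S : CondEmbedding y) {I : Type u} [Finite I]
    {K : I → CHaus κ} {E : CHaus κ} (f : ∀ i, K i ⟶ E) (hf : ∀ x, ∃ i k, (f i).hom k = x) :
    IsCovering y K fun i => y.map (f i) := by
  intro Y g h H
  apply S.sec_injective
  apply (S.functor.obj Y).property.ext_of_jointly_surjective f hf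
  intro i
  rw [← sec_map, ← sec_map, H]

/-- A covering of a representable has a finite jointly surjective subfamily. -/
theorem exists_finset_of_isCovering (S : CondEmbedding y) {I : Type u}
    {K : I → CHaus κ} {E : CHaus κ} (f : ∀ i, K i ⟶ E)
    (hf : IsCovering y K fun i => y.map (f i)) :
    ∃ s : Finset I, ∀ x, ∃ i ∈ s, ∃ k, (f i).hom k = x := by
  classical
  -- The ideal of all subsets covered by finitely many images. Finding the whole of `E` in it is the
  -- claim.
  let N : Order.Ideal (Set E.obj) := Order.IsIdeal.toIdeal
    (I := {A | ∃ s : Finset I, A ⊆ ⋃ i ∈ s, Set.range (f i).hom})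
    { IsLowerSet := fun A B hBA ⟨s, hs⟩ => ⟨s, hBA.trans hs⟩
      Nonempty := ⟨∅, ∅, Set.empty_subset _⟩
      Directed := fun A ⟨s, hs⟩ B ⟨t, ht⟩ => ⟨A ∪ B, ⟨s ∪ t, by
        rw [Finset.set_biUnion_union]
        exact Set.union_subset_union hs ht⟩, Set.subset_union_left, Set.subset_union_right⟩ }
  obtain ⟨G, ⟨ε⟩⟩ := S.glue_mem E N
  let toG {T : CHaus κ} (a : GlueDatum N T) : (S.psh G).obj (op T) :=
    ε.inv.hom.app (op T) a.toSection
  have toG_map {T T' : CHaus κ} (g : T' ⟶ T) (a : GlueDatum N T) :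
      (S.psh G).map g.op (toG a) = toG (a.comap g) :=
    (NatTrans.naturality_apply ε.inv.hom g.op a.toSection).symm
  have toG_inj {T : CHaus κ} {a b : GlueDatum N T} (h : toG a = toG b) : a.Rel b := by
    refine GlueDatum.toSection_eq_iff.mp ?_
    have h' := congrArg (ε.hom.hom.app (op T)) h
    rwa [CondSet.inv_hom_app_apply, CondSet.inv_hom_app_apply] at h'
  obtain ⟨g, hg⟩ := S.sec_surjective (X := G) (toG (GlueDatum.inl N (𝟙 E)))
  obtain ⟨h, hh⟩ := S.sec_surjective (X := G) (toG (GlueDatum.inr N (𝟙 E)))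
  -- Each image lies in `N`, so the two inclusions agree on every member of the jointly epimorphic
  -- family.
  have hgh : g = h := hf g h fun i => S.sec_injective (by
    rw [sec_map, sec_map, hg, hh, toG_map, toG_map]
    refine congrArg (ε.inv.hom.app (op (K i))) (GlueDatum.toSection_eq_iff.mpr ?_)
    exact (GlueDatum.rel_inl_inr_iff (N := N) (f i)).mpr ⟨{i}, by simp⟩)
  rw [hgh, hh] at hg
  obtain ⟨s, hs⟩ := (GlueDatum.rel_inl_inr_iff (N := N) (𝟙 E)).mp (toG_inj hg.symm)
  refine ⟨s, fun x => ?_⟩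
  have := hs ⟨x, rfl⟩
  simpa using this

theorem isQuasicompact_obj (S : CondEmbedding y) (E : CHaus κ) :
    IsQuasicompact.{u} y (y.obj E) := by
  intro I K f hf
  choose f' hf' using fun i => S.map_surjective (f i)
  obtain rfl : (fun i => y.map (f' i)) = f := funext hf'
  obtain ⟨s, hs⟩ := S.exists_finset_of_isCovering f' hf
  refine ⟨s, S.isCovering_of_jointly_surjective (fun i : s => f' i) fun x => ?_⟩
  obtain ⟨i, hi, hx⟩ := hs x
  exact ⟨⟨i, hi⟩, hx⟩

end CondEmbedding

theorem IsQuasicompact.of_iso {𝒦 : Type w} [Category.{v} 𝒦] {𝒞 : Type w'} [Category.{v'} 𝒞]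
    {y : 𝒦 ⥤ 𝒞} {X Y : 𝒞} (e : X ≅ Y) (h : IsQuasicompact.{u} y X) : IsQuasicompact.{u} y Y := by
  intro I K f hf
  obtain ⟨s, hs⟩ := h I K (fun i => f i ≫ e.inv) fun Z a b hab => by
    rw [← cancel_epi e.inv]
    exact hf _ _ fun i => by simpa using hab i
  refine ⟨s, fun Z a b hab => ?_⟩
  rw [← cancel_epi e.hom]
  exact hs _ _ fun i => by simpa using hab i

/-! ### Quasiseparatedness as closed coincidence -/

namespace CondEmbedding

variable {κ : Size.{u}} {𝒟 : Type w} [Category.{v} 𝒟] {y : CHaus κ ⥤ 𝒟} (S : CondEmbedding y)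

/-- The fibre product is represented by the closed coincidence set `A`, and representables are
quasicompact. -/
theorem isQuasiseparated_of_hasClosedCoincidence {X : 𝒟} (h : HasClosedCoincidence (S.psh X)) :
    IsQuasiseparated.{u} y X := by
  intro K f g Z p q hZ
  obtain ⟨A, hA, hA', he⟩ := h (S.sec f) (S.sec g)
  let i := CHaus.closedIncl (CHaus.prod K K) A hA
  have hP : IsPullback (y.map (i ≫ CHaus.fst K K)) (y.map (i ≫ CHaus.snd K K)) f g := by
    refine S.isPullback_of_points (S.sec_injective ?_) ?_ ?_
    · rw [sec_map, sec_map]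
      exact he
    · intro T z z' h₁ h₂
      obtain ⟨z, rfl⟩ := S.map_surjective z
      obtain ⟨z', rfl⟩ := S.map_surjective z'
      rw [← Functor.map_comp, ← Functor.map_comp] at h₁ h₂
      have h₁' := S.map_injective h₁
      have h₂' := S.map_injective h₂
      refine congrArg _ (CHaus.hom_ext fun t => Subtype.ext (Prod.ext ?_ ?_))
      · exact congrArg (fun m : T ⟶ K => m.hom t) h₁'
      · exact congrArg (fun m : T ⟶ K => m.hom t) h₂'
    · intro T a b hab
      obtain ⟨a, rfl⟩ := S.map_surjective a
      obtain ⟨b, rfl⟩ := S.map_surjective b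
      have hab' := congrArg S.sec hab
      rw [sec_map, sec_map] at hab'
      have hmem : ∀ t, (CHaus.pair a b).hom t ∈ A := fun t => hA' _ _ (by
        rw [← pointMap_map, ← pointMap_map, hab'])
      refine ⟨y.map (CHaus.closedLift A hA (CHaus.pair a b) hmem), ?_, ?_⟩
      · rw [← Functor.map_comp]
        rfl
      · rw [← Functor.map_comp]
        rfl
  exact (S.isQuasicompact_obj _).of_iso (hP.isoIsPullback _ _ hZ)

/-- The closed subsets of K × K on which the two sections agree cover the fibre product.
Quasicompactness leaves finitely many of them, and their union is the coincidence set. -/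
theorem coincideOnClosed_of_isQuasiseparated {X : 𝒟} (h : IsQuasiseparated.{u} y X)
    {K : CHaus κ} (φ ψ : (S.psh X).obj (op K)) : CoincideOnClosed φ ψ := by
  classical
  obtain ⟨f, rfl⟩ := S.sec_surjective φ
  obtain ⟨g, rfl⟩ := S.sec_surjective ψ
  have hX := (S.functor.obj X).property
  obtain ⟨Z, ⟨ε⟩⟩ := S.fibre_mem X K (S.sec f) (S.sec g)
  let P := fibrePresheaf (S.sec f) (S.sec g)
  -- the points of `Z`
  let toP {T : CHaus κ} (z : y.obj T ⟶ Z) : P.obj (op T) := ε.hom.hom.app (op T) (S.sec z)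
  have toP_inj {T : CHaus κ} {z z' : y.obj T ⟶ Z} (hz : toP z = toP z') : z = z' := by
    apply S.sec_injective
    have hz' := congrArg (ε.inv.hom.app (op T)) hz
    rwa [CondSet.hom_inv_app_apply, CondSet.hom_inv_app_apply] at hz'
  have toP_surj {T : CHaus κ} (c : P.obj (op T)) : ∃ z : y.obj T ⟶ Z, toP z = c := by
    obtain ⟨z, hz⟩ := S.sec_surjective (X := Z) (ε.inv.hom.app (op T) c)
    refine ⟨z, ?_⟩
    change ε.hom.hom.app (op T) (S.sec z) = c
    rw [hz]
    exact CondSet.inv_hom_app_apply ε c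
  have toP_map {T T' : CHaus κ} (m : T' ⟶ T) (z : y.obj T ⟶ Z) :
      toP (y.map m ≫ z) = P.map m.op (toP z) := by
    change ε.hom.hom.app (op T') (S.sec (y.map m ≫ z)) = _
    rw [sec_map]
    exact NatTrans.naturality_apply ε.hom.hom m.op (S.sec z)
  -- the morphism to the product
  have mid : ∃ m : Z ⟶ y.obj (CHaus.prod K K), ∀ (T : CHaus κ) (z : y.obj T ⟶ Z),
      z ≫ m = y.map (CHaus.pair (toP z).1.1 (toP z).1.2) := by
    let θ : fibreCondSet hX (S.sec f) (S.sec g) ⟶ (CondSet.rep κ).obj (CHaus.prod K K) :=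
      ObjectProperty.homMk
        { app := fun T => TypeCat.ofHom fun c => CHaus.pair c.1.1 c.1.2
          naturality := fun _ _ _ => rfl }
    refine ⟨S.fullyFaithful.preimage (ε.hom ≫ θ ≫ S.iso.inv.app _), fun T z => ?_⟩
    apply S.sec_injective
    rw [sec_of_map, sec_comp]
    dsimp only [pshMap]
    rw [S.fullyFaithful.map_preimage]
    rfl
  obtain ⟨m, hm⟩ := mid
  have hP : IsPullback (m ≫ y.map (CHaus.fst K K)) (m ≫ y.map (CHaus.snd K K)) f g := by
    refine S.isPullback_of_points (S.hom_ext fun T z => S.sec_injective ?_) ?_ ?_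
    · rw [← Category.assoc, ← Category.assoc, ← Category.assoc, ← Category.assoc, hm,
        ← Functor.map_comp, ← Functor.map_comp, sec_map, sec_map]
      exact (toP z).2
    · intro T z z' h₁ h₂
      rw [← Category.assoc, ← Category.assoc, hm, hm, ← Functor.map_comp,
        ← Functor.map_comp] at h₁ h₂
      exact toP_inj (Subtype.ext (Prod.ext (S.map_injective h₁) (S.map_injective h₂)))
    · intro T a b hab
      obtain ⟨a, rfl⟩ := S.map_surjective a
      obtain ⟨b, rfl⟩ := S.map_surjective b
      have hab' := congrArg S.sec hab
      rw [sec_map, sec_map] at hab'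
      obtain ⟨z, hz⟩ := toP_surj ⟨(a, b), hab'⟩
      refine ⟨z, ?_, ?_⟩ <;> rw [← Category.assoc, hm, ← Functor.map_comp, hz] <;> rfl
  -- the covering of `Z` by closed subsets of the product
  let I : Type u := {A : Set (CHaus.prod K K).obj // ∃ hA : IsClosed A,
    (S.psh X).map (CHaus.closedIncl (CHaus.prod K K) A hA ≫ CHaus.fst K K).op (S.sec f) =
      (S.psh X).map (CHaus.closedIncl (CHaus.prod K K) A hA ≫ CHaus.snd K K).op (S.sec g)}
  let F : I → CHaus κ := fun i => CHaus.ofClosed (CHaus.prod K K) i.1 i.2.1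
  choose c hc using fun i : I => toP_surj ⟨(_, _), i.2.2⟩
  have hcm (i : I) : c i ≫ m = y.map (CHaus.closedIncl (CHaus.prod K K) i.1 i.2.1) := by
    rw [hm, hc]
    rfl
  have hcov : IsCovering y F c := by
    intro Y a b hab
    refine S.hom_ext fun T z => ?_
    -- A T-valued point of `Z` factors through the image of T in K × K, which belongs to the family
    -- because agreement of sections descends along T → image.
    let i : I := ⟨Set.range (CHaus.pair (toP z).1.1 (toP z).1.2).hom, CHaus.isClosed_range _,
      hX.map_range_eq _ _ (toP z).2⟩
    have hz : z = y.map (CHaus.toRange (CHaus.pair (toP z).1.1 (toP z).1.2)) ≫ c i := by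
      apply toP_inj
      rw [toP_map]
      exact (congrArg (P.map (CHaus.toRange (CHaus.pair (toP z).1.1 (toP z).1.2)).op) (hc i)).symm
    rw [hz, Category.assoc, Category.assoc, hab]
  obtain ⟨s, hs⟩ := h K f g Z _ _ hP I F c hcov
  have hA : IsClosed (⋃ i : s, i.1.1) := isClosed_iUnion_of_finite fun i => i.1.2.1
  refine ⟨⋃ i : s, i.1.1, hA, fun k l hkl => ?_, ?_⟩
  · by_contra hkA
    -- The Urysohn function r and the constant 0 agree on the finite subcovering, hence after
    -- composition with `m`. Evaluation at the point (k, l) of `Z` then gives 1 = 0.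
    obtain ⟨r, hr₀, hr₁, -⟩ := exists_continuous_zero_one_of_isClosed hA
      (isClosed_singleton (x := ((k, l) : (CHaus.prod K K).obj)))
      (Set.disjoint_singleton_right.mpr hkA)
    let U : CHaus κ := CHaus.of (ULift.{u} unitInterval) κ.bounds_unitInterval
    let r' : CHaus.prod K K ⟶ U := CHaus.homOf (L := U)
      (fun x => ULift.up (Set.projIcc 0 1 zero_le_one (r x)))
      (continuous_uliftUp.comp (continuous_projIcc.comp r.continuous))
    let r₀ : CHaus.prod K K ⟶ U := CHaus.homOf (L := U)
      (fun _ => ULift.up (Set.projIcc 0 1 zero_le_one (0 : ℝ))) continuous_const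
    have heq : m ≫ y.map r' = m ≫ y.map r₀ := hs _ _ fun i => by
      rw [← Category.assoc, ← Category.assoc, hcm, ← Functor.map_comp, ← Functor.map_comp]
      refine congrArg _ (CHaus.hom_ext fun x => ?_)
      have hx : r x.1 = 0 := hr₀ (Set.mem_iUnion.mpr ⟨i, x.2⟩)
      exact congrArg (fun v => ULift.up (Set.projIcc 0 1 zero_le_one v)) hx
    obtain ⟨z, hz⟩ := toP_surj ⟨(CHaus.const K k, CHaus.const K l), hkl⟩
    have heq' := congrArg (fun t => z ≫ t) heq
    simp only [← Category.assoc] at heq'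
    rw [hm, hz, ← Functor.map_comp, ← Functor.map_comp] at heq'
    have h₁ := congrArg (fun t : CHaus.pt κ ⟶ U => ((t.hom PUnit.unit).down : ℝ))
      (S.map_injective heq')
    change ((Set.projIcc 0 1 zero_le_one (r (k, l)) : unitInterval) : ℝ) =
      ((Set.projIcc 0 1 zero_le_one 0 : unitInterval) : ℝ) at h₁
    have hkl₁ : r (k, l) = 1 := hr₁ rfl
    rw [hkl₁, Set.projIcc_right, Set.projIcc_left] at h₁
    exact one_ne_zero h₁
  · have hsub (i : s) : ∀ x, (CHaus.closedIncl (CHaus.prod K K) i.1.1 i.1.2.1).hom x ∈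
        ⋃ i : s, i.1.1 := fun x => Set.mem_iUnion.mpr ⟨i, x.2⟩
    refine hX.ext_of_jointly_surjective
      (fun i : s => CHaus.closedLift _ hA (CHaus.closedIncl _ _ i.1.2.1) (hsub i)) ?_ fun i => ?_
    · rintro ⟨x, hx⟩
      obtain ⟨i, hi⟩ := Set.mem_iUnion.mp hx
      exact ⟨i, ⟨x, hi⟩, rfl⟩
    · rw [map_map_apply, map_map_apply]
      exact i.1.2.2

theorem isQuasiseparated_iff {X : 𝒟} :
    IsQuasiseparated.{u} y X ↔ HasClosedCoincidence (S.psh X) :=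
  ⟨fun h => .of_self (S.functor.obj X).property fun _ φ =>
    S.coincideOnClosed_of_isQuasiseparated h φ φ, S.isQuasiseparated_of_hasClosedCoincidence⟩

end CondEmbedding

/-- The identity embedding of `Cond_κ`. -/
def CondEmbedding.condSet (κ : Size.{u}) : CondEmbedding (CondSet.rep κ) where
  functor := 𝟭 _
  fullyFaithful := Functor.FullyFaithful.id _
  iso := Iso.refl _
  glue_mem _ _ := ⟨_, ⟨Iso.refl _⟩⟩
  fibre_mem _ _ _ _ := ⟨_, ⟨Iso.refl _⟩⟩

/-- The embedding of condensed sets into sheaves on all compact Hausdorff spaces. -/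
def CondEmbedding.cond : CondEmbedding Cond.rep.{u} where
  functor := ObjectProperty.ι _
  fullyFaithful := ObjectProperty.fullyFaithfulι _
  iso := Iso.refl _
  glue_mem E N := by
    obtain ⟨κ, h₀, h₁, hE⟩ := Size.exists_bounds E.obj
    exact ⟨⟨glueCondSet N, isSmallCondensed_of_isLocallyBounded (h₀ := h₀) (h₁ := h₁) _
      (isLocallyBounded_gluePresheaf (Size.le_all _) ⟨E.obj, hE⟩ N)⟩, ⟨Iso.refl _⟩⟩
  fibre_mem X K φ ψ := by
    obtain ⟨κ, h₀, h₁, hK⟩ := Size.exists_bounds K.obj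
    exact ⟨⟨fibreCondSet X.obj.property φ ψ,
      isSmallCondensed_of_isLocallyBounded (h₀ := h₀) (h₁ := h₁) _
        (isLocallyBounded_fibrePresheaf (Size.le_all _) X.obj.property ⟨K.obj, hK⟩ φ ψ)⟩,
      ⟨Iso.refl _⟩⟩

/-! ### Quotients of compact Hausdorff spaces -/

/-- The saturation of C is the second projection of the part of the kernel relation lying over C,
and projections along a compact factor are closed. -/
theorem isClosedMap_of_isClosed_ker {K S : Type*} [TopologicalSpace K] [CompactSpace K]
    [TopologicalSpace S] {f : K → S} (hf : Topology.IsQuotientMap f)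
    (hR : IsClosed {x : K × K | f x.1 = f x.2}) : IsClosedMap f := by
  intro C hC
  rw [← hf.isClosed_preimage]
  convert isClosedMap_snd_of_compactSpace _ (hR.inter (hC.preimage continuous_fst)) using 1
  ext y
  constructor
  · rintro ⟨x, hx, hxy⟩
    exact ⟨(x, y), ⟨hxy, hx⟩, rfl⟩
  · rintro ⟨⟨x, y⟩, ⟨hxy, hx⟩, rfl⟩
    exact ⟨x, hx, hxy⟩

/-- Two fibres are disjoint closed sets in a normal space. Since the map is closed, separating
neighbourhoods shrink to saturated ones. -/
theorem t2Space_of_isClosed_ker {K S : Type*} [TopologicalSpace K] [CompactSpace K] [T2Space K]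
    [TopologicalSpace S] {f : K → S} (hf : Topology.IsQuotientMap f)
    (hR : IsClosed {x : K × K | f x.1 = f x.2}) : T2Space S := by
  have hc := isClosedMap_of_isClosed_ker hf hR
  have hfib (s : S) : IsClosed (f ⁻¹' {s}) := by
    obtain ⟨k, rfl⟩ := hf.surjective s
    exact hR.preimage (f := fun x : K => (x, k)) (by fun_prop)
  refine ⟨fun x y hxy => ?_⟩
  obtain ⟨U, V, hU, hV, hxU, hyV, hUV⟩ := normal_separation (hfib x) (hfib y)
    (Disjoint.preimage f (Set.disjoint_singleton.mpr hxy))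
  refine ⟨(f '' Uᶜ)ᶜ, (f '' Vᶜ)ᶜ, (hc _ hU.isClosed_compl).isOpen_compl,
    (hc _ hV.isClosed_compl).isOpen_compl, ?_, ?_, ?_⟩
  · rintro ⟨k, hk, rfl⟩
    exact hk (hxU rfl)
  · rintro ⟨k, hk, rfl⟩
    exact hk (hyV rfl)
  · refine Set.disjoint_left.mpr fun s hs hs' => ?_
    obtain ⟨k, rfl⟩ := hf.surjective s
    have hkU : k ∈ U := by_contra fun h => hs ⟨k, h, rfl⟩
    have hkV : k ∈ V := by_contra fun h => hs' ⟨k, h, rfl⟩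
    exact Set.disjoint_left.mp hUV hkU hkV

/-! ### Morphisms of compactological sets -/

theorem Compactology.exists_subset {X : Type u} (c : Compactology X) {J : Type*} [Finite J]
    (S : J → c.sets) : ∃ T : c.sets, ∀ j, (S j : Set X) ⊆ T := by
  have : Nonempty c.sets := c.sets_nonempty.to_subtype
  have : IsDirectedOrder c.sets := ⟨fun A B => by
    obtain ⟨D, hD, hA, hB⟩ := c.directed A A.2 B B.2
    exact ⟨⟨D, hD⟩, hA, hB⟩⟩
  exact Finite.exists_le S

/-- It suffices to be continuous into some member containing the image: the image is then compact,
so it is a member by stability, and by coherence its topology is the induced one. -/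
theorem IsCmpMap.of_exists {X Y : Type u} {c : Compactology X} {d : Compactology Y} {f : X → Y}
    (h : ∀ K : c.sets, ∃ (S : d.sets) (hS : ∀ k : (K : Set X), f k ∈ (S : Set Y)),
      @Continuous _ _ (c.top K) (d.top S) fun k : (K : Set X) => (⟨f k, hS k⟩ : (S : Set Y))) :
    IsCmpMap c d f := by
  have hmem : ∀ K ∈ c.sets, f '' K ∈ d.sets := by
    intro K hK
    obtain ⟨S, hS, hc⟩ := h ⟨K, hK⟩
    let _ := c.top ⟨K, hK⟩
    let _ := d.top S
    have := c.compactSpace ⟨K, hK⟩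
    have := d.compact_mem S _ (isCompact_range hc)
    rwa [← Set.range_comp, show Subtype.val ∘ (fun k : K => (⟨f k, hS k⟩ : (S : Set Y))) =
      f ∘ Subtype.val from rfl, Set.range_comp, Subtype.range_coe] at this
  refine ⟨hmem, fun K => ?_⟩
  obtain ⟨S, hS, hc⟩ := h K
  have hsub : f '' (K : Set X) ⊆ S := by
    rintro _ ⟨k, hk, rfl⟩
    exact hS ⟨k, hk⟩
  rw [d.coherent S ⟨_, hmem K K.2⟩ hsub]
  let _ := c.top K
  let _ := d.top S
  exact continuous_induced_rng.mpr hc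

theorem Compactology.continuous_of_subset {K : Type u} [TopologicalSpace K] {Y : Type u}
    {d : Compactology Y} {f : K → Y} {S T : d.sets} (h : (S : Set Y) ⊆ T)
    (hS : ∀ k, f k ∈ (S : Set Y))
    (hc : @Continuous _ _ _ (d.top S) fun k => (⟨f k, hS k⟩ : (S : Set Y))) :
    @Continuous _ _ _ (d.top T) fun k => (⟨f k, h (hS k)⟩ : (T : Set Y)) :=
  @Continuous.comp _ _ _ _ (d.top S) (d.top T) _ _ (d.continuous_inclusion S T h) hc

section Compact

variable {K : Type u} [TopologicalSpace K] [CompactSpace K] [T2Space K] {Y : Type u}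
  {d : Compactology Y} {f : K → Y}

theorem IsCmpMap.of_continuous (S : d.sets) (hS : ∀ k, f k ∈ (S : Set Y))
    (hc : @Continuous _ _ _ (d.top S) fun k => (⟨f k, hS k⟩ : (S : Set Y))) :
    IsCmpMap (compactologyOfCompact K) d f :=
  .of_exists fun A => ⟨S, fun k => hS k, by
    let _ := d.top S
    exact hc.comp (continuous_subtype_val (p := fun x => x ∈ (A : Set K)))⟩

/-- Together with `IsCmpMap.of_continuous`, this identifies the morphisms from a compact space with
the continuous maps into a single member. -/
theorem IsCmpMap.exists_continuous (hf : IsCmpMap (compactologyOfCompact K) d f) :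
    ∃ (S : d.sets) (hS : ∀ k, f k ∈ (S : Set Y)), (S : Set Y) = Set.range f ∧
      @Continuous _ _ _ (d.top S) fun k => (⟨f k, hS k⟩ : (S : Set Y)) := by
  have hm := hf.image_mem Set.univ isCompact_univ
  refine ⟨⟨_, hm⟩, fun k => ⟨k, trivial, rfl⟩, Set.image_univ, ?_⟩
  let _ := d.top ⟨_, hm⟩
  have hc := hf.continuous ⟨Set.univ, isCompact_univ⟩
  have hu : Continuous fun k : K => (⟨k, trivial⟩ : (Set.univ : Set K)) := by fun_prop
  exact hc.comp hu

end Compact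

/-! ### The condensed set of a compactological set -/

section RestrictedYoneda

variable {κ : Size.{u}} {C : Cmp κ}

/-- The section of the restricted Yoneda presheaf given by a map. -/
def cmpSection {K : CHaus κ} (f : K.obj → C.obj.carrier)
    (hf : IsCmpMap (compactologyOfCompact K.obj) C.obj.str f) :
    ((restrictedYoneda κ).obj C).obj (op K) :=
  show (CHaus.toCmp κ).obj K ⟶ C from
    ObjectProperty.homMk (⟨f, hf⟩ : CmpSet.Hom ((CHaus.toCmp κ).obj K).obj C.obj)

/-- The map underlying a section of the restricted Yoneda presheaf. -/
def cmpFun {K : CHaus κ} (s : ((restrictedYoneda κ).obj C).obj (op K)) :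
    K.obj → C.obj.carrier :=
  CmpSet.Hom.toFun (show (CHaus.toCmp κ).obj K ⟶ C from s).hom

theorem isCmpMap_cmpFun {K : CHaus κ} (s : ((restrictedYoneda κ).obj C).obj (op K)) :
    IsCmpMap (compactologyOfCompact K.obj) C.obj.str (cmpFun s) :=
  CmpSet.Hom.isCmpMap (show (CHaus.toCmp κ).obj K ⟶ C from s).hom

theorem cmpFun_injective {K : CHaus κ} :
    Function.Injective (cmpFun : ((restrictedYoneda κ).obj C).obj (op K) → _) :=
  fun _ _ h => ObjectProperty.hom_ext _ (CmpSet.Hom.ext h)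

/-- Finite coproducts work because finitely many members lie in a common one; descent works because
a surjection of compact Hausdorff spaces is a quotient map. -/
theorem isCondensed_restrictedYoneda (κ : Size.{u}) (C : Cmp κ) :
    IsCondensed κ ((restrictedYoneda κ).obj C) := by
  refine isCondensed_of_elementwise ?_ ?_ ?_
  · intro J _ K φ
    choose S hS _ hc using fun j => (isCmpMap_cmpFun (φ j)).exists_continuous
    obtain ⟨T, hT⟩ := C.obj.str.exists_subset S
    refine ⟨cmpSection (K := CHaus.sigma K) (fun x => cmpFun (φ x.1) x.2)
      (.of_continuous T (fun x => hT x.1 (hS x.1 x.2)) ?_), fun j => rfl, fun χ hχ => ?_⟩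
    · let _ := C.obj.str.top T
      exact continuous_sigma fun j => Compactology.continuous_of_subset (hT j) (hS j) (hc j)
    · refine cmpFun_injective (funext fun x => ?_)
      exact congrFun (congrArg cmpFun (hχ x.1)) x.2
  · intro K L f hf s t h
    refine cmpFun_injective (funext fun x => ?_)
    obtain ⟨k, rfl⟩ := hf x
    exact congrFun (congrArg cmpFun h) k
  · intro K L f hf s h
    have key (a b : K.obj) (hab : f.hom a = f.hom b) : cmpFun s a = cmpFun s b :=
      congrFun (congrArg cmpFun h) ⟨(a, b), hab⟩
    obtain ⟨S, hS, _, hc⟩ := (isCmpMap_cmpFun s).exists_continuous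
    have hg (k : K.obj) : cmpFun s (Function.surjInv hf (f.hom k)) = cmpFun s k :=
      key _ _ (Function.surjInv_eq hf _)
    refine ⟨cmpSection (fun l => cmpFun s (Function.surjInv hf l))
      (.of_continuous S (fun l => hS _) ?_), cmpFun_injective (funext hg)⟩
    let _ := C.obj.str.top S
    rw [(CHaus.isQuotientMap f hf).continuous_iff]
    convert hc using 1
    funext k
    exact Subtype.ext (hg k)

/-- By directedness both maps land in one member, and that member is Hausdorff. -/
theorem hasClosedCoincidence_restrictedYoneda (κ : Size.{u}) (C : Cmp κ) :
    HasClosedCoincidence ((restrictedYoneda κ).obj C) := by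
  intro K L φ ψ
  obtain ⟨S, hS, _, hcS⟩ := (isCmpMap_cmpFun φ).exists_continuous
  obtain ⟨T, hT, _, hcT⟩ := (isCmpMap_cmpFun ψ).exists_continuous
  obtain ⟨R, hR, hSR, hTR⟩ := C.obj.str.directed S S.2 T T.2
  let _ := C.obj.str.top ⟨R, hR⟩
  have := C.obj.str.t2Space ⟨R, hR⟩
  have h₁ := Compactology.continuous_of_subset (T := ⟨R, hR⟩) hSR hS hcS
  have h₂ := Compactology.continuous_of_subset (T := ⟨R, hR⟩) hTR hT hcT
  have hA : IsClosed {x : (CHaus.prod K L).obj |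
      (⟨cmpFun φ ((CHaus.fst K L).hom x), hSR (hS _)⟩ : R) =
        ⟨cmpFun ψ ((CHaus.snd K L).hom x), hTR (hT _)⟩} :=
    isClosed_eq (h₁.comp (CHaus.continuous_hom (CHaus.fst K L)))
      (h₂.comp (CHaus.continuous_hom (CHaus.snd K L)))
  refine ⟨_, hA, fun k l hkl => ?_, cmpFun_injective (funext fun x => ?_)⟩
  · exact Subtype.ext (congrFun (congrArg cmpFun hkl) PUnit.unit)
  · exact congrArg Subtype.val x.2

end RestrictedYoneda

/-! ### The compactology of a quasiseparated condensed set -/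

section Underlying

variable {κ : Size.{u}} {X : (CHaus κ)ᵒᵖ ⥤ Type u}

theorem HasClosedCoincidence.isClosed (hX : HasClosedCoincidence X) {K L : CHaus κ}
    (φ : X.obj (op K)) (ψ : X.obj (op L)) :
    IsClosed {x : K.obj × L.obj | pointMap X φ x.1 = pointMap X ψ x.2} := by
  obtain ⟨A, hA, hA', he⟩ := hX φ ψ
  convert hA using 1
  ext x
  refine ⟨fun hx => hA' _ _ hx, fun hx => ?_⟩
  have := congrArg (fun s => pointMap X s (⟨x, hx⟩ : A)) he
  rw [pointMap_map, pointMap_map] at this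
  exact this

/-- If φ and ψ agree at all points, the diagonal of K factors through the closed set on which they
agree as sections. -/
theorem HasClosedCoincidence.ext (hX : HasClosedCoincidence X) {K : CHaus κ}
    {φ ψ : X.obj (op K)} (h : ∀ k, pointMap X φ k = pointMap X ψ k) : φ = ψ := by
  obtain ⟨A, hA, hA', he⟩ := hX φ ψ
  have := congrArg (X.map (CHaus.closedLift A hA (CHaus.pair (𝟙 K) (𝟙 K))
    fun k => hA' _ _ (h k)).op) he
  rw [map_map_apply, map_map_apply] at this
  exact (map_id_apply φ).symm.trans (this.trans (map_id_apply ψ))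

/-- The quotient topology on the image of `φ_*`. -/
abbrev sectionTop {K : CHaus κ} (φ : X.obj (op K)) {S : Set (underlyingSet X)}
    (hS : S = Set.range (pointMap X φ)) : TopologicalSpace S :=
  TopologicalSpace.coinduced (fun k : K.obj => (⟨pointMap X φ k, hS ▸ ⟨k, rfl⟩⟩ : S)) inferInstance

theorem isQuotientMap_sectionTop {K : CHaus κ} (φ : X.obj (op K)) {S : Set (underlyingSet X)}
    (hS : S = Set.range (pointMap X φ)) :
    @Topology.IsQuotientMap _ _ _ (sectionTop φ hS)
      (fun k : K.obj => (⟨pointMap X φ k, hS ▸ ⟨k, rfl⟩⟩ : S)) := by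
  let _ := sectionTop φ hS
  refine ⟨⟨rfl⟩, ?_⟩
  rintro ⟨x, hx⟩
  obtain ⟨k, rfl⟩ : x ∈ Set.range (pointMap X φ) := hS ▸ hx
  exact ⟨k, rfl⟩

/-- The preimage in K of a closed subset of S is the projection of a closed subset of K × L, cut out
by coincidence, and L is compact. For φ and ψ with the same image this shows that both define the
same quotient topology. -/
theorem HasClosedCoincidence.continuous_pointMap (hX : HasClosedCoincidence X) {K L : CHaus κ}
    (φ : X.obj (op K)) (ψ : X.obj (op L)) {S : Set (underlyingSet X)}
    (hS : S = Set.range (pointMap X ψ)) (h : ∀ k, pointMap X φ k ∈ S) :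
    @Continuous _ _ _ (sectionTop ψ hS) fun k : K.obj => (⟨pointMap X φ k, h k⟩ : S) := by
  let _ := sectionTop ψ hS
  have hq := isQuotientMap_sectionTop ψ hS
  refine continuous_iff_isClosed.mpr fun A hA => ?_
  convert isClosedMap_fst_of_compactSpace _
    ((hX.isClosed φ ψ).inter ((hA.preimage hq.continuous).preimage continuous_snd)) using 1
  ext k
  constructor
  · intro hk
    obtain ⟨l, hl⟩ := hq.surjective ⟨pointMap X φ k, h k⟩
    refine ⟨(k, l), ⟨(congrArg Subtype.val hl).symm, ?_⟩, rfl⟩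
    exact (congrArg (· ∈ A) hl).mpr hk
  · rintro ⟨⟨k, l⟩, ⟨hkl, hl⟩, rfl⟩
    have : (⟨pointMap X φ k, h k⟩ : S) = ⟨pointMap X ψ l, hS ▸ ⟨l, rfl⟩⟩ := Subtype.ext hkl
    exact (congrArg (· ∈ A) this).mpr hl

/-- The compactology on `X(*)` by the images of all maps `φ_*`. -/
noncomputable def underlyingCompactology (hc : IsCondensed κ X) (hX : HasClosedCoincidence X) :
    Compactology (underlyingSet X) where
  sets := imageSets X
  -- One section with image `S` is chosen; by `HasClosedCoincidence.continuous_pointMap` the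
  -- topology does not depend on the choice.
  top S := sectionTop S.2.choose_spec.choose S.2.choose_spec.choose_spec
  sets_nonempty := by
    -- The empty coproduct carries a section.
    obtain ⟨x, -, -⟩ := hc.existsUnique_sigma (J := PEmpty) (fun j => j.elim) (fun j => j.elim)
    exact ⟨_, _, x, rfl⟩
  compactSpace S := by
    let _ := sectionTop S.2.choose_spec.choose S.2.choose_spec.choose_spec
    have hq := isQuotientMap_sectionTop S.2.choose_spec.choose S.2.choose_spec.choose_spec
    exact hq.surjective.compactSpace hq.continuous
  t2Space S := by
    let _ := sectionTop S.2.choose_spec.choose S.2.choose_spec.choose_spec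
    refine t2Space_of_isClosed_ker (isQuotientMap_sectionTop _ S.2.choose_spec.choose_spec) ?_
    simpa only [Subtype.mk.injEq] using hX.isClosed _ _
  covers := by
    refine Set.eq_univ_of_forall fun x => ⟨_, ⟨CHaus.pt κ, x, rfl⟩, PUnit.unit, ?_⟩
    exact map_id_apply x
  directed := by
    rintro _ ⟨K, φ, rfl⟩ _ ⟨L, ψ, rfl⟩
    obtain ⟨M, f, g, χ, rfl, rfl⟩ := hc.exists_union φ ψ
    refine ⟨_, ⟨M, χ, rfl⟩, ?_, ?_⟩
    · rintro _ ⟨k, rfl⟩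
      exact ⟨f.hom k, (pointMap_map f χ k).symm⟩
    · rintro _ ⟨k, rfl⟩
      exact ⟨g.hom k, (pointMap_map g χ k).symm⟩
  coherent S T h := by
    let t₁ := sectionTop S.2.choose_spec.choose S.2.choose_spec.choose_spec
    let t₂ := sectionTop T.2.choose_spec.choose T.2.choose_spec.choose_spec
    have hqS := isQuotientMap_sectionTop S.2.choose_spec.choose S.2.choose_spec.choose_spec
    have hqT := isQuotientMap_sectionTop T.2.choose_spec.choose T.2.choose_spec.choose_spec
    have : CompactSpace T := hqT.surjective.compactSpace hqT.continuous
    have : T2Space S := by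
      refine t2Space_of_isClosed_ker hqS ?_
      simpa only [Subtype.mk.injEq] using hX.isClosed _ _
    have hcont : Continuous (Set.inclusion h) := by
      rw [hqT.continuous_iff]
      exact hX.continuous_pointMap _ _ S.2.choose_spec.choose_spec _
    -- A continuous injection from a compact to a Hausdorff space is an embedding.
    exact (hcont.isClosedEmbedding (Set.inclusion_injective h)).eq_induced
  compact_mem S A hA := by
    let _ := sectionTop S.2.choose_spec.choose S.2.choose_spec.choose_spec
    have hq := isQuotientMap_sectionTop S.2.choose_spec.choose S.2.choose_spec.choose_spec
    have : T2Space S := by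
      refine t2Space_of_isClosed_ker hq ?_
      simpa only [Subtype.mk.injEq] using hX.isClosed _ _
    have hA' : IsClosed A := hA.isClosed
    -- The compact subset is the image of the restriction of the chosen section to its closed
    -- preimage.
    refine ⟨_, X.map (CHaus.closedIncl _ _ (hA'.preimage hq.continuous)).op
      S.2.choose_spec.choose, ?_⟩
    ext x
    constructor
    · rintro ⟨a, ha, rfl⟩
      obtain ⟨k, rfl⟩ := hq.surjective a
      exact ⟨⟨k, ha⟩, pointMap_map _ _ _⟩
    · rintro ⟨k, rfl⟩
      rw [pointMap_map]
      exact ⟨_, k.2, rfl⟩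

theorem underlyingCompactology_continuous (hc : IsCondensed κ X) (hX : HasClosedCoincidence X)
    {K : CHaus κ} (φ : X.obj (op K)) (S : (underlyingCompactology hc hX).sets)
    (h : ∀ k, pointMap X φ k ∈ (S : Set (underlyingSet X))) :
    @Continuous _ _ _ ((underlyingCompactology hc hX).top S) fun k : K.obj =>
      (⟨pointMap X φ k, h k⟩ : (S : Set (underlyingSet X))) :=
  hX.continuous_pointMap φ _ S.2.choose_spec.choose_spec h

/-- Every member of the compactology carries a quotient topology. -/
theorem underlyingCompactology_exists_isQuotientMap (hc : IsCondensed κ X)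
    (hX : HasClosedCoincidence X) (S : (underlyingCompactology hc hX).sets) :
    ∃ (K : CHaus κ) (φ : X.obj (op K)) (h : ∀ k, pointMap X φ k ∈ (S : Set (underlyingSet X))),
      @Topology.IsQuotientMap _ _ _ ((underlyingCompactology hc hX).top S) fun k : K.obj =>
        (⟨pointMap X φ k, h k⟩ : (S : Set (underlyingSet X))) :=
  ⟨_, _, _, isQuotientMap_sectionTop S.2.choose_spec.choose S.2.choose_spec.choose_spec⟩

/-- A map out of the underlying compactological set is a morphism if its compositions with the maps
`φ_*` are. -/
theorem isCmpMap_of_pointMap (hc : IsCondensed κ X) (hX : HasClosedCoincidence X) {Y : Type u}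
    {d : Compactology Y} {f : underlyingSet X → Y}
    (h : ∀ (K : CHaus κ) (φ : X.obj (op K)),
      IsCmpMap (compactologyOfCompact K.obj) d fun k => f (pointMap X φ k)) :
    IsCmpMap (underlyingCompactology hc hX) d f := by
  refine .of_exists fun S => ?_
  obtain ⟨K, φ, hφ, hq⟩ := underlyingCompactology_exists_isQuotientMap hc hX S
  obtain ⟨T, hT, _, hcT⟩ := (h K φ).exists_continuous
  let _ := (underlyingCompactology hc hX).top S
  let _ := d.top T
  refine ⟨T, fun s => ?_, hq.continuous_iff.mpr hcT⟩
  obtain ⟨k, rfl⟩ := hq.surjective s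
  exact hT k

theorem isCmpMap_pointMap (hc : IsCondensed κ X) (hX : HasClosedCoincidence X) {K : CHaus κ}
    (φ : X.obj (op K)) :
    IsCmpMap (compactologyOfCompact K.obj) (underlyingCompactology hc hX) (pointMap X φ) :=
  .of_continuous (d := underlyingCompactology hc hX) ⟨_, K, φ, rfl⟩ (fun k => ⟨k, rfl⟩)
    (underlyingCompactology_continuous hc hX φ ⟨_, K, φ, rfl⟩ fun k => ⟨k, rfl⟩)

theorem isCmpMap_app (hc : IsCondensed κ X) (hX : HasClosedCoincidence X)
    {Y : (CHaus κ)ᵒᵖ ⥤ Type u} (hc' : IsCondensed κ Y) (hY : HasClosedCoincidence Y)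
    (η : X ⟶ Y) : IsCmpMap (underlyingCompactology hc hX) (underlyingCompactology hc' hY)
      (η.app (op (CHaus.pt κ))) :=
  isCmpMap_of_pointMap hc hX fun K φ => by
    simpa only [← pointMap_app] using isCmpMap_pointMap hc' hY (η.app (op K) φ)

/-- A morphism to the underlying compactological set comes from a section. -/
theorem exists_pointMap_eq (hc : IsCondensed κ X) (hX : HasClosedCoincidence X) {K : CHaus κ}
    {f : K.obj → underlyingSet X}
    (hf : IsCmpMap (compactologyOfCompact K.obj) (underlyingCompactology hc hX) f) :
    ∃ φ : X.obj (op K), pointMap X φ = f := by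
  obtain ⟨S, hS, _, hcS⟩ := hf.exists_continuous
  obtain ⟨L, ψ, hψ, hq⟩ := underlyingCompactology_exists_isQuotientMap hc hX S
  let _ := (underlyingCompactology hc hX).top S
  have := (underlyingCompactology hc hX).t2Space S
  have hR : IsClosed {x : (CHaus.prod K L).obj |
      (⟨f ((CHaus.fst K L).hom x), hS _⟩ : (S : Set (underlyingSet X))) =
        ⟨pointMap X ψ ((CHaus.snd K L).hom x), hψ _⟩} :=
    isClosed_eq (hcS.comp (CHaus.continuous_hom (CHaus.fst K L)))
      (hq.continuous.comp (CHaus.continuous_hom (CHaus.snd K L)))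
  -- The fibre product of f and ψ_* over the Hausdorff member S. It surjects onto K, and the
  -- pullback of ψ to it descends along this surjection; the descent condition is checked on points,
  -- where ψ_* ∘ q = f ∘ p.
  let R := CHaus.ofClosed (CHaus.prod K L) _ hR
  let p : R ⟶ K := CHaus.closedIncl _ _ hR ≫ CHaus.fst K L
  let q : R ⟶ L := CHaus.closedIncl _ _ hR ≫ CHaus.snd K L
  have hpq (r : R.obj) : f (p.hom r) = pointMap X ψ (q.hom r) := congrArg Subtype.val r.2
  have hp : Function.Surjective p.hom := fun k => by
    obtain ⟨l, hl⟩ := hq.surjective ⟨f k, hS k⟩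
    exact ⟨⟨(k, l), hl.symm⟩, rfl⟩
  obtain ⟨φ, hφ⟩ := hc.exists_desc p hp (X.map q.op ψ) (hX.ext fun r => by
    rw [pointMap_map, pointMap_map, pointMap_map, pointMap_map, ← hpq, ← hpq]
    exact congrArg f (congrArg (fun t : CHaus.pullback p p ⟶ K => t.hom r)
      (CHaus.pullback_condition p p)))
  refine ⟨φ, funext fun k => ?_⟩
  obtain ⟨r, rfl⟩ := hp k
  rw [← pointMap_map, hφ, pointMap_map, hpq]

end Underlying

/-! ### The equivalence on the level of presheaves -/

section Equivalence

variable {κ : Size.{u}} {𝒟 : Type w} [Category.{v} 𝒟] {j : 𝒟 ⥤ ((CHaus κ)ᵒᵖ ⥤ Type u)}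

/-- The underlying compactologies of a category of condensed sets with closed coincidence. -/
noncomputable def UnderlyingCompactology.of (hc : ∀ X, IsCondensed κ (j.obj X))
    (hX : ∀ X, HasClosedCoincidence (j.obj X)) : UnderlyingCompactology j where
  cmp X := underlyingCompactology (hc X) (hX X)
  sets_eq _ := rfl
  isCmpMap X Y η := isCmpMap_app (hc X) (hX X) (hc Y) (hX Y) (j.map η)

/-- A condensed set with closed coincidence is recovered from its underlying compactological set,
a section `φ` corresponding to the map `φ_*`. -/
noncomputable def UnderlyingCompactology.ofUnit (hc : ∀ X, IsCondensed κ (j.obj X))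
    (hX : ∀ X, HasClosedCoincidence (j.obj X)) :
    j ≅ (UnderlyingCompactology.of hc hX).functor ⋙ restrictedYoneda κ :=
  NatIso.ofComponents
    (fun X => NatIso.ofComponents
      (fun K => Equiv.toIso (Equiv.ofBijective
        (fun φ => cmpSection (C := (UnderlyingCompactology.of hc hX).functor.obj X)
          (K := K.unop) (pointMap (j.obj X) φ) (isCmpMap_pointMap (hc X) (hX X) φ))
        ⟨fun φ ψ h => (hX X).ext fun k => congrFun (congrArg cmpFun h) k, fun s => by
          obtain ⟨φ, hφ⟩ := exists_pointMap_eq (hc X) (hX X) (isCmpMap_cmpFun s)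
          exact ⟨φ, cmpFun_injective hφ⟩⟩))
      (fun f => by
        refine ConcreteCategory.hom_ext _ _ fun φ => ?_
        apply cmpFun_injective
        exact funext fun k => pointMap_map f.unop φ k))
    (fun η => by
      refine NatTrans.ext (funext fun K => ConcreteCategory.hom_ext _ _ fun φ => ?_)
      apply cmpFun_injective
      exact funext fun k => pointMap_app (j.map η) φ k)

/-- The section over the point given by an element of a compactological set. -/
def cmpPoint {C : Cmp κ} (x : C.obj.carrier) : underlyingSet ((restrictedYoneda κ).obj C) :=
  cmpSection (K := CHaus.pt κ) (fun _ => x) (by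
    obtain ⟨S, hS, hx⟩ : x ∈ ⋃₀ C.obj.str.sets := C.obj.str.covers ▸ Set.mem_univ x
    let _ := C.obj.str.top ⟨S, hS⟩
    exact .of_continuous ⟨S, hS⟩ (fun _ => hx) continuous_const)

theorem cmpPoint_cmpFun {C : Cmp κ} (s : underlyingSet ((restrictedYoneda κ).obj C)) :
    cmpPoint (cmpFun s PUnit.unit) = s :=
  cmpFun_injective (funext fun _ => rfl)

/-- A member of the compactology as a compact Hausdorff space. -/
def Cmp.member (C : Cmp κ) (S : C.obj.str.sets) : CHaus κ :=
  letI := C.obj.str.top S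
  haveI := C.obj.str.compactSpace S
  haveI := C.obj.str.t2Space S
  CHaus.of (S : Set C.obj.carrier) (C.property S S.2)

theorem Cmp.isCmpMap_member (C : Cmp κ) (S : C.obj.str.sets) :
    IsCmpMap (compactologyOfCompact (C.member S).obj) C.obj.str
      (fun x : (S : Set C.obj.carrier) => (x : C.obj.carrier)) := by
  let _ := C.obj.str.top S
  exact .of_continuous (K := (C.member S).obj) S (fun x => x.2) continuous_id

/-- The inclusion of a member S is itself a section over S, and its point map is the restriction of
`cmpPoint` to S. -/
theorem isCmpMap_cmpPoint (C : Cmp κ) :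
    IsCmpMap C.obj.str (underlyingCompactology (isCondensed_restrictedYoneda κ C)
      (hasClosedCoincidence_restrictedYoneda κ C)) cmpPoint := by
  refine .of_exists fun S => ?_
  let φ : ((restrictedYoneda κ).obj C).obj (op (C.member S)) :=
    cmpSection _ (C.isCmpMap_member S)
  have h := underlyingCompactology_continuous (isCondensed_restrictedYoneda κ C)
    (hasClosedCoincidence_restrictedYoneda κ C) φ ⟨_, _, φ, rfl⟩ fun k => ⟨k, rfl⟩
  exact ⟨⟨_, _, φ, rfl⟩, fun k => ⟨k, rfl⟩, h⟩

theorem isCmpMap_eval (C : Cmp κ) :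
    IsCmpMap (underlyingCompactology (isCondensed_restrictedYoneda κ C)
      (hasClosedCoincidence_restrictedYoneda κ C)) C.obj.str fun s => cmpFun s PUnit.unit :=
  isCmpMap_of_pointMap _ _ fun _ φ => isCmpMap_cmpFun φ

/-- A compactological set is recovered from its condensed set by evaluation at the point. -/
def cmpEvalIso (C : Cmp κ) :
    (⟨underlyingSet ((restrictedYoneda κ).obj C),
      underlyingCompactology (isCondensed_restrictedYoneda κ C)
        (hasClosedCoincidence_restrictedYoneda κ C)⟩ : CmpSet.{u}) ≅ C.obj where
  hom := (⟨_, isCmpMap_eval C⟩ : CmpSet.Hom _ _)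
  inv := (⟨_, isCmpMap_cmpPoint C⟩ : CmpSet.Hom _ _)
  hom_inv_id := by
    apply CmpSet.Hom.ext
    exact funext fun s => cmpPoint_cmpFun s
  inv_hom_id := rfl

end Equivalence

/-! ### Change of size -/

section Change

variable {κ κ' : Size.{u}} (h : κ ≤ κ')

/-- The restricted Yoneda presheaves for different size bounds agree on small spaces. -/
def restrictedYonedaResIso :
    restrictedYoneda κ ≅ Cmp.incl h ⋙ restrictedYoneda κ' ⋙ presheafRes h :=
  NatIso.ofComponents
    (fun C => NatIso.ofComponents
      (fun K =>
        { hom := TypeCat.ofHom fun s => cmpSection (C := (Cmp.incl h).obj C)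
            (K := (CHaus.incl h).obj K.unop) (cmpFun (K := K.unop) s) (isCmpMap_cmpFun s)
          inv := TypeCat.ofHom fun s => cmpSection (C := C) (K := K.unop)
            (cmpFun (C := (Cmp.incl h).obj C) (K := (CHaus.incl h).obj K.unop) s)
            (isCmpMap_cmpFun (C := (Cmp.incl h).obj C) (K := (CHaus.incl h).obj K.unop) s)
          hom_inv_id := rfl
          inv_hom_id := rfl })
      (fun _ => rfl))
    (fun _ => rfl)

/-- A map from T lands continuously in one member S, which is κ-bounded, so it is pulled back from
the inclusion of S; no covering of T is needed. -/
theorem isLocallyBounded_restrictedYoneda (C : Cmp κ) :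
    IsLocallyBounded h ((restrictedYoneda κ').obj ((Cmp.incl h).obj C)) := by
  intro T s
  obtain ⟨S, hS, _, hc⟩ := (isCmpMap_cmpFun s).exists_continuous
  refine ⟨T, 𝟙 T, C.member S,
    CHaus.homOf (L := (CHaus.incl h).obj (C.member S)) 
      (fun t => ⟨cmpFun (C := (Cmp.incl h).obj C) s t, hS t⟩) hc,
    cmpSection (C := (Cmp.incl h).obj C) (K := (CHaus.incl h).obj (C.member S)) _
      (C.isCmpMap_member S), Function.surjective_id, ?_⟩
  exact cmpFun_injective (funext fun _ => rfl)

theorem IsLocallyBounded.of_iso {h : κ ≤ κ'} {Y Y' : (CHaus κ')ᵒᵖ ⥤ Type u}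
    (hY : IsLocallyBounded h Y) (e : Y ≅ Y') : IsLocallyBounded h Y' := by
  intro T y
  obtain ⟨T', p, E, a, z, hp, hz⟩ := hY T (e.inv.app (op T) y)
  refine ⟨T', p, E, a, e.hom.app _ z, hp, ?_⟩
  have hz' := congrArg (e.hom.app (op T')) hz
  have h₁ := NatTrans.naturality_apply e.hom p.op (e.inv.app (op T) y)
  have h₂ := NatTrans.naturality_apply e.hom a.op z
  have h₃ : e.hom.app (op T) (e.inv.app (op T) y) = y := by simp
  rw [h₁, h₃] at hz'
  exact hz'.trans h₂

end Change

theorem isUniversalRes_restrictedYoneda {κ κ' : Size.{u}} (h : κ ≤ κ') (C : Cmp κ) :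
    IsUniversalRes h
      (X := (yonedaCondSet κ (isCondensed_restrictedYoneda κ)).obj C)
      (Y := (yonedaCondSet κ' (isCondensed_restrictedYoneda κ')).obj ((Cmp.incl h).obj C))
      ((restrictedYonedaResIso h).hom.app C) :=
  isUniversalRes_of_isLocallyBounded h
    (X := (yonedaCondSet κ (isCondensed_restrictedYoneda κ)).obj C)
    (Y := (yonedaCondSet κ' (isCondensed_restrictedYoneda κ')).obj ((Cmp.incl h).obj C))
    ((restrictedYonedaResIso h).app C) (isLocallyBounded_restrictedYoneda h C)

/-- Every compactological set is bounded by some uncountable strong limit cardinal. -/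
theorem Cmp.exists_bounds (C : Cmp Size.all.{u}) :
    ∃ (κ : Cardinal.{u}) (h₀ : Cardinal.aleph0 < κ) (h₁ : κ.IsStrongLimit)
      (C' : Cmp (Size.of κ h₀ h₁)), (Cmp.incl (Size.le_all _)).obj C' = C := by
  -- A bound for the whole underlying set bounds all members at once.
  obtain ⟨κ, h₀, h₁, hC⟩ := Size.exists_bounds C.obj.carrier
  exact ⟨κ, h₀, h₁, ⟨C.obj, fun K _ => hC.subtype K⟩, rfl⟩

theorem isSmallCondensed_restrictedYoneda (C : Cmp Size.all.{u}) :
    IsSmallCondensed ((yonedaCondSet _ (isCondensed_restrictedYoneda _)).obj C) := by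
  obtain ⟨κ, h₀, h₁, C', rfl⟩ := C.exists_bounds
  exact ⟨κ, h₀, h₁, _, _, isUniversalRes_restrictedYoneda (Size.le_all _) C'⟩

/-! ### The quasi-inverse equivalences -/

theorem isQuasiseparated_yonedaCondSet (κ : Size.{u}) (C : Cmp κ) :
    IsQuasiseparated.{u} (CondSet.rep κ)
      ((yonedaCondSet κ (isCondensed_restrictedYoneda κ)).obj C) :=
  (CondEmbedding.condSet κ).isQuasiseparated_iff.mpr (hasClosedCoincidence_restrictedYoneda κ C)

theorem isQuasiseparated_yonedaCond (C : Cmp Size.all.{u}) :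
    IsQuasiseparated.{u} Cond.rep
      ((yonedaCond (isCondensed_restrictedYoneda _) isSmallCondensed_restrictedYoneda).obj C) :=
  CondEmbedding.cond.isQuasiseparated_iff.mpr (hasClosedCoincidence_restrictedYoneda _ C)

theorem QsCondSet.isCondensed {κ : Size.{u}} (X : QsCondSet κ) :
    IsCondensed κ ((QsCondSet.toPresheaf κ).obj X) :=
  X.obj.property

theorem QsCondSet.hasClosedCoincidence {κ : Size.{u}} (X : QsCondSet κ) :
    HasClosedCoincidence ((QsCondSet.toPresheaf κ).obj X) :=
  (CondEmbedding.condSet κ).isQuasiseparated_iff.mp X.property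

theorem QsCond.isCondensed (X : QsCond.{u}) :
    IsCondensed Size.all (QsCond.toPresheaf.obj X) :=
  X.obj.obj.property

theorem QsCond.hasClosedCoincidence (X : QsCond.{u}) :
    HasClosedCoincidence (QsCond.toPresheaf.obj X) :=
  CondEmbedding.cond.isQuasiseparated_iff.mp X.property

/-- The restricted Yoneda functor to quasiseparated `κ`-condensed sets. -/
abbrev cmpToQsCondSet (κ : Size.{u}) : Cmp κ ⥤ QsCondSet κ :=
  yonedaQsCondSet κ (isCondensed_restrictedYoneda κ) (isQuasiseparated_yonedaCondSet κ)

/-- The restricted Yoneda functor to quasiseparated condensed sets. -/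
abbrev cmpToQsCond : Cmp Size.all.{u} ⥤ QsCond.{u} :=
  yonedaQsCond (isCondensed_restrictedYoneda _) isSmallCondensed_restrictedYoneda
    isQuasiseparated_yonedaCond

/-- The underlying compactologies of quasiseparated `κ`-condensed sets. -/
noncomputable abbrev QsCondSet.underlying (κ : Size.{u}) :
    UnderlyingCompactology (QsCondSet.toPresheaf κ) :=
  .of QsCondSet.isCondensed QsCondSet.hasClosedCoincidence

/-- The underlying compactologies of quasiseparated condensed sets. -/
noncomputable abbrev QsCond.underlying : UnderlyingCompactology QsCond.toPresheaf.{u} :=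
  .of QsCond.isCondensed QsCond.hasClosedCoincidence

/-- The presheaf of a quasiseparated `κ`-condensed set is recovered from the underlying
compactological set. -/
noncomputable abbrev QsCondSet.unit (κ : Size.{u}) :
    QsCondSet.toPresheaf κ ≅ (QsCondSet.underlying κ).functor ⋙ restrictedYoneda κ :=
  UnderlyingCompactology.ofUnit QsCondSet.isCondensed QsCondSet.hasClosedCoincidence

/-- The presheaf of a quasiseparated condensed set is recovered from the underlying compactological
set. -/
noncomputable abbrev QsCond.unit :
    QsCond.toPresheaf.{u} ≅ QsCond.underlying.functor ⋙ restrictedYoneda Size.all :=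
  UnderlyingCompactology.ofUnit QsCond.isCondensed QsCond.hasClosedCoincidence

/-- The underlying compactological set of the condensed set of a `κ`-compactological set. -/
noncomputable def cmpToQsCondSetUnderlyingIso (κ : Size.{u}) :
    cmpToQsCondSet κ ⋙ (QsCondSet.underlying κ).functor ≅ 𝟭 (Cmp κ) :=
  NatIso.ofComponents (fun C => ObjectProperty.isoMk _ (cmpEvalIso C)) fun _ => rfl

/-- The `κ`-condensed set of the underlying compactological set. -/
noncomputable def underlyingCmpToQsCondSetIso (κ : Size.{u}) :
    (QsCondSet.underlying κ).functor ⋙ cmpToQsCondSet κ ≅ 𝟭 (QsCondSet κ) :=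
  (NatIso.ofComponents
    (fun X => ObjectProperty.isoMk _ (ObjectProperty.isoMk _ ((QsCondSet.unit κ).app X)))
    fun f => ObjectProperty.hom_ext _ (ObjectProperty.hom_ext _
      ((QsCondSet.unit κ).hom.naturality f)) :
    𝟭 (QsCondSet κ) ≅ (QsCondSet.underlying κ).functor ⋙ cmpToQsCondSet κ).symm

/-- The underlying compactological set of the condensed set of a compactological set. -/
noncomputable def cmpToQsCondUnderlyingIso :
    cmpToQsCond ⋙ QsCond.underlying.functor ≅ 𝟭 (Cmp Size.all.{u}) :=
  NatIso.ofComponents (fun C => ObjectProperty.isoMk _ (cmpEvalIso C)) fun _ => rfl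

/-- The condensed set of the underlying compactological set. -/
noncomputable def underlyingCmpToQsCondIso :
    QsCond.underlying.functor ⋙ cmpToQsCond ≅ 𝟭 QsCond.{u} :=
  (NatIso.ofComponents
    (fun X => ObjectProperty.isoMk _ (ObjectProperty.isoMk _ (ObjectProperty.isoMk _
      (QsCond.unit.app X))))
    fun f => ObjectProperty.hom_ext _ (ObjectProperty.hom_ext _ (ObjectProperty.hom_ext _
      (QsCond.unit.hom.naturality f))) :
    𝟭 QsCond.{u} ≅ QsCond.underlying.functor ⋙ cmpToQsCond).symm

/-- The restricted Yoneda functor and the underlying compactological set functor are quasi-inverse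
equivalences between `κ`-compactological sets and quasiseparated `κ`-condensed sets, for every
uncountable strong limit cardinal `κ`, and also between all compactological sets and all
quasiseparated condensed sets. The latter equivalence extends the former ones along the inclusions
`Cmp_κ ⥤ Cmp` and the functors `Cond_κ ⥤ Cond` (left adjoint to restriction), under which
quasiseparated objects correspond. -/
theorem mainTheorem1 :
    -- the restricted Yoneda functor takes values in `κ`-condensed sets
    ∃ hc : ∀ (κ : Size.{u}) (C : Cmp κ), IsCondensed κ ((restrictedYoneda κ).obj C),
      -- the equivalence for an uncountable strong limit cardinal
      (∀ (κ₀ : Cardinal.{u}) (h₀ : Cardinal.aleph0 < κ₀) (h₁ : κ₀.IsStrongLimit),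
        ∃ (hq : ∀ C : Cmp (Size.of κ₀ h₀ h₁),
            IsQuasiseparated.{u} (CondSet.rep _) ((yonedaCondSet _ (hc _)).obj C))
          (U : UnderlyingCompactology (QsCondSet.toPresheaf (Size.of κ₀ h₀ h₁))),
          Nonempty (yonedaQsCondSet _ (hc _) hq ⋙ U.functor ≅ 𝟭 (Cmp (Size.of κ₀ h₀ h₁))) ∧
          Nonempty (U.functor ⋙ yonedaQsCondSet _ (hc _) hq ≅
            𝟭 (QsCondSet (Size.of κ₀ h₀ h₁)))) ∧
      -- the equivalence without size restriction
      (∃ (hs : ∀ C : Cmp Size.all.{u}, IsSmallCondensed ((yonedaCondSet _ (hc _)).obj C))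
          (hq : ∀ C : Cmp Size.all.{u},
            IsQuasiseparated.{u} Cond.rep ((yonedaCond (hc _) hs).obj C))
          (U : UnderlyingCompactology QsCond.toPresheaf.{u}),
          Nonempty (yonedaQsCond (hc _) hs hq ⋙ U.functor ≅ 𝟭 (Cmp Size.all.{u})) ∧
          Nonempty (U.functor ⋙ yonedaQsCond (hc _) hs hq ≅ 𝟭 QsCond.{u})) ∧
      -- compatibility with the transition functors `Cmp_κ ⥤ Cmp_κ'` and `Cond_κ ⥤ Cond_κ'`,
      -- including `κ' = ⊤`
      (∀ (κ κ' : Size.{u}) (h : κ ≤ κ'),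
        ∃ α : restrictedYoneda κ ≅ Cmp.incl h ⋙ restrictedYoneda κ' ⋙ presheafRes h,
          ∀ C : Cmp κ, IsUniversalRes h
            (X := (yonedaCondSet κ (hc κ)).obj C)
            (Y := (yonedaCondSet κ' (hc κ')).obj ((Cmp.incl h).obj C))
            (α.hom.app C)) ∧
      -- `Cond_κ ⥤ Cond` maps quasiseparated objects to quasiseparated objects
      (∀ (κ₀ : Cardinal.{u}) (h₀ : Cardinal.aleph0 < κ₀) (h₁ : κ₀.IsStrongLimit)
        (X : QsCondSet (Size.of κ₀ h₀ h₁)),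
        ∃ (Z : QsCond.{u})
          (e : X.obj.obj ≅ (presheafRes (Size.le_all (Size.of κ₀ h₀ h₁))).obj Z.obj.obj.obj),
          IsUniversalRes (Size.le_all _) (X := X.obj) (Y := Z.obj.obj) e.hom) ∧
      -- every quasiseparated condensed set arises in this way
      (∀ Z : QsCond.{u}, ∃ (κ₀ : Cardinal.{u}) (h₀ : Cardinal.aleph0 < κ₀)
        (h₁ : κ₀.IsStrongLimit) (X : QsCondSet (Size.of κ₀ h₀ h₁))
        (e : X.obj.obj ≅ (presheafRes (Size.le_all (Size.of κ₀ h₀ h₁))).obj Z.obj.obj.obj),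
        IsUniversalRes (Size.le_all _) (X := X.obj) (Y := Z.obj.obj) e.hom) := by
  refine ⟨isCondensed_restrictedYoneda, fun κ₀ h₀ h₁ => ?_, ?_, fun κ κ' h => ?_,
    fun κ₀ h₀ h₁ X => ?_, fun Z => ?_⟩
  · exact ⟨isQuasiseparated_yonedaCondSet _, QsCondSet.underlying _,
      ⟨cmpToQsCondSetUnderlyingIso _⟩, ⟨underlyingCmpToQsCondSetIso _⟩⟩
  · exact ⟨isSmallCondensed_restrictedYoneda, isQuasiseparated_yonedaCond, QsCond.underlying,
      ⟨cmpToQsCondUnderlyingIso⟩, ⟨underlyingCmpToQsCondIso⟩⟩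
  · exact ⟨restrictedYonedaResIso h, isUniversalRes_restrictedYoneda h⟩
  · have hle := Size.le_all (Size.of κ₀ h₀ h₁)
    -- The image of `X` in Cond is realised by the compactological set of `X`, regarded without size
    -- bound.
    let C := (QsCondSet.underlying _).functor.obj X
    exact ⟨cmpToQsCond.obj ((Cmp.incl hle).obj C),
      (QsCondSet.unit _).app X ≪≫ (restrictedYonedaResIso hle).app C,
      isUniversalRes_of_isLocallyBounded hle (X := X.obj)
        (Y := (yonedaCondSet _ (isCondensed_restrictedYoneda _)).obj ((Cmp.incl hle).obj C))
        ((QsCondSet.unit _).app X ≪≫ (restrictedYonedaResIso hle).app C)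
        (isLocallyBounded_restrictedYoneda hle C)⟩
  -- Conversely, the compactological set of `Z` is bounded by some κ₀, and its κ₀-condensed set is
  -- the required object.
  · obtain ⟨κ₀, h₀, h₁, C, hC⟩ := (QsCond.underlying.functor.obj Z).exists_bounds
    have hle := Size.le_all (Size.of κ₀ h₀ h₁)
    let e : (restrictedYoneda _).obj ((Cmp.incl hle).obj C) ≅ QsCond.toPresheaf.obj Z :=
      (restrictedYoneda _).mapIso (eqToIso hC) ≪≫ (QsCond.unit.app Z).symm
    exact ⟨κ₀, h₀, h₁, (cmpToQsCondSet _).obj C,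
      (restrictedYonedaResIso hle).app C ≪≫ (presheafRes hle).mapIso e,
      isUniversalRes_of_isLocallyBounded hle (X := ((cmpToQsCondSet _).obj C).obj) (Y := Z.obj.obj)
        ((restrictedYonedaResIso hle).app C ≪≫ (presheafRes hle).mapIso e)
        ((isLocallyBounded_restrictedYoneda hle C).of_iso e)⟩
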